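/- \textbf{Definitions.} For a finite simple graph $G$ on $n$ vertices let $\mathbf X_G=\sum_\kappa\prod_{v\in V(G)}x_{\kappa(v)}$ be its chromatic symmetric function (the sum is over all proper colorings $\kappa:V(G)\to\mathbb N$). For a partition $\lambda=(\lambda_1,\dots,\lambda_\ell)$ let $\mathfrak{st}_\lambda=\mathbf X_{\mathsf{St}_{\lambda_1}}\cdots\mathbf X_{\mathsf{St}_{\lambda_\ell}}$, where $\mathsf{St}_k$ is the star on $k$ vertices. The $\mathfrak{st}_\lambda$ with $\lambda\vdash n$ form a basis of the homogeneous symmetric functions of degree $n$ over $\mathbb Q$, so $\mathbf X_G=\sum_{\lambda\vdash n}c_\lambda\,\mathfrak{st}_\lambda$ for unique $c_\lambda\in\mathbb Q$. The leading partition $\lambda_{\mathrm{lead}}$ is the lexicographically smallest $\lambda$ with $c_\lambda\neq0$, and $c_{\lambda_{\mathrm{lead}}}$ is the leading coefficient of $\mathbf X_G$. A graph is unicyclic if it contains exactly one cycle. Removing the edges of the cycle from a connected unicyclic graph $G$ leaves one tree rooted at each cycle vertex; let $r$ be the number of these trees that have more than one vertex. A leaf is a vertex of degree one. A deep vertex is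 a vertex of degree at least two with no adjacent leaf. A sprout is a deep vertex on the cycle of degree at least three. \textbf{Theorem.} Let $G$ be a finite simple connected unicyclic graph with $r\ge2$. Let $b_1,\dots,b_s$ ($s\ge0$) be the degrees of the sprouts of $G$, and let $d_1,\dots,d_p$ ($p\ge0$) be the degrees of the deep vertices of $G$ that are not sprouts. Then \[ c_{\lambda_{\mathrm{lead}}}=(-1)^{p+s}\prod_{i=1}^p(d_i-1)\cdot \begin{cases} \prod_{i=1}^s(b_i-1)-\sum_{i=1}^s b_i+2s-1 & \text{if } r=s,\\ \prod_{i=1}^s(b_i-1)-1 & \text{if } r=s+1,\\ \prod_{i=1}^s(b_i-1) & \text{if } r\ge s+2. \end{cases} \] -/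

import Mathlib

/-! ### Chromatic symmetric functions and star expansions -/

/-- The chromatic symmetric function of a finite graph, as a formal power series in the
commuting variables `x₀, x₁, x₂, …`: it is the sum over all proper colorings `κ : V → ℕ` of the
monomials `∏ v, x_{κ v}`.  So the coefficient of the monomial `x^d` is the (finite) number of
proper colorings using every color `i` exactly `d i` times. -/
noncomputable def chromaticSymm {V : Type*} [Fintype V] (G : SimpleGraph V) :
    MvPowerSeries ℕ ℚ :=
  fun d => (Nat.card {κ : G.Coloring ℕ // ∑ v, Finsupp.single (κ v) 1 = d} : ℚ)

/-- The chromatic symmetric function `𝔰𝔱_k` of the star on `k` vertices (for `k = 0`, which never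
occurs as a part of a partition, that of the empty graph). -/
noncomputable def starSymm : ℕ → MvPowerSeries ℕ ℚ
  | 0 => 1
  | k + 1 => chromaticSymm (SimpleGraph.starGraph (0 : Fin (k + 1)))

/-- `𝔰𝔱_λ = 𝔰𝔱_{λ₁} 𝔰𝔱_{λ₂} ⋯ 𝔰𝔱_{λ_ℓ}`. -/
noncomputable def starSymmPart {n : ℕ} (lam : n.Partition) : MvPowerSeries ℕ ℚ :=
  (lam.parts.map starSymm).prod

/-- `c` is a family of coefficients writing the chromatic symmetric function of `G` in terms of
the star basis: `X_G = ∑_{λ ⊢ n} c_λ 𝔰𝔱_λ`. -/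
def IsStarExpansion {V : Type*} [Fintype V] (G : SimpleGraph V)
    (c : (Fintype.card V).Partition → ℚ) : Prop :=
  chromaticSymm G = ∑ lam, c lam • starSymmPart lam

/-- The parts `λ₁ ≥ λ₂ ≥ ⋯ ≥ λ_ℓ` of a partition as a weakly decreasing list. -/
def partsList {n : ℕ} (lam : n.Partition) : List ℕ :=
  lam.parts.sort (· ≥ ·)

/-- `lam` is the lexicographically smallest partition with non-zero coefficient. The order `≤` on
lists of natural numbers is the lexicographic one. -/
def IsLeadingPartition {n : ℕ} (c : n.Partition → ℚ) (lam : n.Partition) : Prop :=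
  c lam ≠ 0 ∧ ∀ mu : n.Partition, c mu ≠ 0 → partsList lam ≤ partsList mu

namespace SimpleGraph

/-! ### Unicyclic graphs -/

variable {V : Type*} (G : SimpleGraph V)

/-- The subgraph `C` of `G` is a cycle, i.e. it consists of the vertices and edges of a closed walk
without repetitions. -/
def IsCycleSubgraph (C : G.Subgraph) : Prop :=
  ∃ (u : V) (w : G.Walk u u), w.IsCycle ∧ w.toSubgraph = C

/-- A unicyclic graph is a graph containing exactly one cycle. -/
def IsUnicyclic : Prop := ∃! C : G.Subgraph, G.IsCycleSubgraph C

/-- The vertices lying on a cycle of `G`. -/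
def cycleVerts : Set V := {v | ∃ C : G.Subgraph, G.IsCycleSubgraph C ∧ v ∈ C.verts}

/-- The edges lying on a cycle of `G`. -/
def cycleEdges : Set (Sym2 V) := {e | ∃ C : G.Subgraph, G.IsCycleSubgraph C ∧ e ∈ C.edgeSet}

/-- For a cycle vertex `v` of a unicyclic graph: the vertex set of the tree rooted at `v`,
that is, of the component of `v` once the edges of the cycle are removed. -/
def rootedTreeVerts (v : V) : Set V :=
  ((G.deleteEdges G.cycleEdges).connectedComponentMk v).supp

/-- The roots of the non-trivial rooted trees: cycle vertices whose tree has more than one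
vertex. -/
def nontrivialRoots : Set V := {v | v ∈ G.cycleVerts ∧ (G.rootedTreeVerts v).Nontrivial}

/-! ### Vertex types -/

variable [Fintype V] [DecidableRel G.Adj]

/-- A leaf is a vertex of degree one. -/
def IsLeafVert (v : V) : Prop := G.degree v = 1

/-- A deep vertex is an internal vertex (degree at least two) that has no adjacent leaves. -/
def IsDeep (v : V) : Prop := 2 ≤ G.degree v ∧ ∀ w, G.Adj v w → ¬ G.IsLeafVert w

/-- A sprout is a deep vertex on the cycle that has degree at least three. -/
def IsSprout (v : V) : Prop := G.IsDeep v ∧ v ∈ G.cycleVerts ∧ 3 ≤ G.degree v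

open Classical in
/-- The finite set of sprouts. -/
noncomputable def sprouts : Finset V := {v | G.IsSprout v}

open Classical in
/-- The finite set of deep vertices that are not sprouts. -/
noncomputable def nonSproutDeep : Finset V := {v | G.IsDeep v ∧ ¬ G.IsSprout v}

end SimpleGraph

/-! Leaves are summed out first. On the graph of internal vertices (degree at least two), a vertex
of color `i` with `l v` adjacent leaves gets weight `x_i (P - x_i)^(l v)`, where `P` is the sum of
the variables. Inclusion–exclusion over internal edges turns `X_G` into a signed sum over edge sets
`S`, with a factor `∑ x_i^c (P - x_i)^m` for every component having `c` vertices and `m` leaves.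
Expanding `x_i^(c-1) = (P - (P - x_i))^(c-1)` makes each factor a combination of `st_{m+j+1}
st_1^(c-1-j)` (`chromaticSymm_eq_sum`).

The lexicographically smallest partition that can occur has the parts `l v + 1`. It arises exactly
when `j = 0` everywhere and no component of `S` contains two vertices with adjacent leaves. Its
coefficient is therefore the signed count of such sets `S` (`sum_expansionCoeff_leadParts`).

For this count, write `L(q) = q_0 + q_1` and attach to an edge `uv` the polynomial `X_u + X_v - X_u
X_v = 1 - (1 - X_u)(1 - X_v)`. For a forest, the product of `L` over the components equals the
square-free evaluation of the vertex and edge polynomials (`sqfreeSum_forest`). If all `S` were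
forests, the signed sum would collapse to a product over vertices. The sets containing the cycle
give one correction term, supported on the cycle (`signed_sum_unicyclic`). Substituting `X` at
vertices with leaves and `1` elsewhere yields the formula (`IsUnicyclic.signed_count`).

The value is nonzero for `r ≥ 2` by a Weierstrass product inequality, so this partition really
leads. The coefficients are unique because power sums are combinations of products of stars and are
linearly independent. -/

set_option linter.unusedSectionVars false

open Finset

namespace SimpleGraph

/-! ### Blocks of an edge set -/

section Blocks

variable {W : Type*} [Fintype W]

/-- The vertices reachable from `v` along the edges in `S`. -/
noncomputable def blockOf (S : Finset (Sym2 W)) (v : W) : Finset W := by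
  classical exact {w | (fromEdgeSet (S : Set (Sym2 W))).Reachable v w}

/-- The vertex sets of the connected components of the graph with edge set `S`. -/
noncomputable def blocks (S : Finset (Sym2 W)) : Finset (Finset W) := by
  classical exact univ.image (blockOf S)

theorem mem_blockOf {S : Finset (Sym2 W)} {v w : W} :
    w ∈ blockOf S v ↔ (fromEdgeSet (S : Set (Sym2 W))).Reachable v w := by
  simp [blockOf]

theorem self_mem_blockOf (S : Finset (Sym2 W)) (v : W) : v ∈ blockOf S v :=
  mem_blockOf.2 (Reachable.refl v)

theorem blockOf_eq_iff {S : Finset (Sym2 W)} {v w : W} :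
    blockOf S v = blockOf S w ↔ (fromEdgeSet (S : Set (Sym2 W))).Reachable v w := by
  constructor
  · intro h
    rw [← mem_blockOf, h]
    exact self_mem_blockOf S w
  · intro h
    ext x
    rw [mem_blockOf, mem_blockOf]
    exact ⟨fun hx => h.symm.trans hx, fun hx => h.trans hx⟩

theorem blockOf_mem_blocks (S : Finset (Sym2 W)) (v : W) : blockOf S v ∈ blocks S := by
  simp [blocks]

theorem mem_blocks {S : Finset (Sym2 W)} {C : Finset W} :
    C ∈ blocks S ↔ ∃ v, blockOf S v = C := by
  simp [blocks]

theorem eq_blockOf {S : Finset (Sym2 W)} {C : Finset W} (hC : C ∈ blocks S) {v : W}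
    (hv : v ∈ C) : C = blockOf S v := by
  obtain ⟨w, rfl⟩ := mem_blocks.1 hC
  exact blockOf_eq_iff.2 (mem_blockOf.1 hv)

theorem nonempty_of_mem_blocks {S : Finset (Sym2 W)} {C : Finset W} (hC : C ∈ blocks S) :
    C.Nonempty := by
  obtain ⟨w, rfl⟩ := mem_blocks.1 hC
  exact ⟨w, self_mem_blockOf S w⟩

theorem pairwiseDisjoint_blocks (S : Finset (Sym2 W)) :
    (blocks S : Set (Finset W)).PairwiseDisjoint id := by
  intro C hC D hD hne
  rw [Function.onFun, id, id, Finset.disjoint_left]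
  intro x hx hx'
  exact hne ((eq_blockOf hC hx).trans (eq_blockOf hD hx').symm)

/-- The blocks partition the vertices. -/
theorem prod_blocks {M : Type*} [CommMonoid M] (S : Finset (Sym2 W)) (f : W → M) :
    ∏ C ∈ blocks S, ∏ v ∈ C, f v = ∏ v, f v := by
  classical
  have h : (univ : Finset W) = (blocks S).biUnion id := by
    ext v
    simp only [mem_univ, mem_biUnion, id, true_iff]
    exact ⟨_, blockOf_mem_blocks S v, self_mem_blockOf S v⟩
  rw [h, prod_biUnion (pairwiseDisjoint_blocks S)]
  rfl

theorem sum_blocks {M : Type*} [AddCommMonoid M] (S : Finset (Sym2 W)) (f : W → M) :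
    ∑ C ∈ blocks S, ∑ v ∈ C, f v = ∑ v, f v := by
  classical
  have h : (univ : Finset W) = (blocks S).biUnion id := by
    ext v
    simp only [mem_univ, mem_biUnion, id, true_iff]
    exact ⟨_, blockOf_mem_blocks S v, self_mem_blockOf S v⟩
  rw [h, sum_biUnion (pairwiseDisjoint_blocks S)]
  rfl

theorem blockOf_empty (v : W) : blockOf (∅ : Finset (Sym2 W)) v = {v} := by
  ext w
  rw [mem_blockOf]
  simp [reachable_bot, eq_comm]

theorem prod_blocks_empty {M : Type*} [CommMonoid M] (f : Finset W → M) :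
    ∏ C ∈ blocks (∅ : Finset (Sym2 W)), f C = ∏ v, f {v} := by
  classical
  have : blocks (∅ : Finset (Sym2 W)) = univ.image (fun v : W => ({v} : Finset W)) := by
    ext C
    simp [mem_blocks, blockOf_empty]
  rw [this, prod_image]
  intro a _ b _ h
  exact Finset.singleton_injective h

theorem fromEdgeSet_insert_adj [DecidableEq W] {S : Finset (Sym2 W)} {u v x y : W} :
    (fromEdgeSet ((insert s(u, v) S : Finset (Sym2 W)) : Set (Sym2 W))).Adj x y ↔
      x ≠ y ∧ ((x = u ∧ y = v ∨ x = v ∧ y = u) ∨ s(x, y) ∈ S) := by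
  simp [and_comm]

/-- Two blocks joined by a new edge get merged. -/
theorem mem_blockOf_insert [DecidableEq W] {S : Finset (Sym2 W)} {u v : W} {x y : W} :
    y ∈ blockOf (insert s(u, v) S) x ↔
      (if blockOf S x = blockOf S v then blockOf S u else blockOf S x) =
        (if blockOf S y = blockOf S v then blockOf S u else blockOf S y) := by
  classical
  have hmono : ∀ {a b : W}, blockOf S a = blockOf S b →
      (fromEdgeSet ((insert s(u, v) S : Finset (Sym2 W)) : Set (Sym2 W))).Reachable a b :=
    fun {a b} h => (blockOf_eq_iff.1 h).mono (fromEdgeSet_mono (by simp))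
  have huv : (fromEdgeSet ((insert s(u, v) S : Finset (Sym2 W)) : Set (Sym2 W))).Reachable u v := by
    by_cases h : u = v
    · rw [h]
    · exact Adj.reachable (fromEdgeSet_insert_adj.2 ⟨h, by simp⟩)
  rw [mem_blockOf]
  constructor
  · intro h
    rw [reachable_iff_reflTransGen] at h
    induction h with
    | refl => rfl
    | @tail b c _ hbc ih =>
      rw [ih]
      obtain ⟨hne, h | h⟩ := fromEdgeSet_insert_adj.1 hbc
      · rcases h with ⟨rfl, rfl⟩ | ⟨rfl, rfl⟩ <;> simp
      · have : blockOf S b = blockOf S c :=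
          blockOf_eq_iff.2 (Adj.reachable ((fromEdgeSet_adj _).2 ⟨h, hne⟩))
        rw [this]
  · intro h
    by_cases hx : blockOf S x = blockOf S v <;> by_cases hy : blockOf S y = blockOf S v
    · exact hmono (hx.trans hy.symm)
    · rw [if_pos hx, if_neg hy] at h
      exact (hmono hx).trans (huv.symm.trans (hmono h))
    · rw [if_neg hx, if_pos hy] at h
      exact (hmono h).trans (huv.trans (hmono hy.symm))
    · rw [if_neg hx, if_neg hy] at h
      exact hmono h

/-- `T` collects the blocks untouched by the new edge. One `T` serves all `f`, so products for
different weights can be compared. -/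
theorem exists_blocks_insert [DecidableEq W] {S : Finset (Sym2 W)} {u v : W}
    (huv : blockOf S u ≠ blockOf S v) :
    ∃ T : Finset (Finset W), (∀ C ∈ T, u ∉ C ∧ v ∉ C) ∧
      ∀ {M : Type} [CommMonoid M] (f : Finset W → M),
        ∏ C ∈ blocks S, f C = f (blockOf S u) * f (blockOf S v) * ∏ C ∈ T, f C ∧
        ∏ C ∈ blocks (insert s(u, v) S), f C =
          f (blockOf S u ∪ blockOf S v) * ∏ C ∈ T, f C := by
  classical
  refine ⟨((blocks S).erase (blockOf S u)).erase (blockOf S v), ?_, ?_⟩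
  · intro C hC
    simp only [mem_erase] at hC
    exact ⟨fun h => hC.2.1 (eq_blockOf hC.2.2 h), fun h => hC.1 (eq_blockOf hC.2.2 h)⟩
  intro M _ f
  have h1 : blocks (insert s(u, v) S) =
      insert (blockOf S u ∪ blockOf S v) (((blocks S).erase (blockOf S u)).erase (blockOf S v)) := by
    have key : ∀ x, blockOf (insert s(u, v) S) x =
        if blockOf S x = blockOf S u ∨ blockOf S x = blockOf S v then blockOf S u ∪ blockOf S v
        else blockOf S x := by
      intro x
      ext y
      rw [mem_blockOf_insert]
      have e : ∀ z, y ∈ blockOf S z ↔ blockOf S y = blockOf S z := fun z => by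
        rw [mem_blockOf, ← blockOf_eq_iff, eq_comm]
      split_ifs with h1 h2 h3 h4 h5 h6 <;> simp only [mem_union, e] <;> grind
    ext C
    simp only [mem_insert, mem_erase, mem_blocks, key]
    constructor
    · rintro ⟨x, rfl⟩
      split_ifs with h
      · exact Or.inl rfl
      · push Not at h
        exact Or.inr ⟨h.2, h.1, x, rfl⟩
    · rintro (rfl | ⟨h1, h2, x, rfl⟩)
      · exact ⟨u, by simp⟩
      · exact ⟨x, by simp [h1, h2]⟩
  constructor
  · rw [← mul_prod_erase (blocks S) f (blockOf_mem_blocks S u),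
      ← mul_prod_erase ((blocks S).erase (blockOf S u)) f (a := blockOf S v), mul_assoc]
    exact mem_erase.2 ⟨huv.symm, blockOf_mem_blocks S v⟩
  · rw [h1, prod_insert]
    intro h
    simp only [mem_erase] at h
    exact h.2.1 (eq_blockOf h.2.2 (mem_union_left _ (self_mem_blockOf S u)))

end Blocks


/-! ### Square-free evaluation -/

section SquareFree

variable {W : Type*} [Fintype W]

/-- The sum of the coefficients of all square-free monomials. -/
noncomputable def sqfreeSum : MvPolynomial W ℚ →ₗ[ℚ] ℚ := by
  classical
  exact (MvPolynomial.basisMonomials W ℚ).constr ℚ (fun m => if ∀ v, m v ≤ 1 then 1 else 0)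

/-- The sum of the two lowest coefficients of a polynomial. -/
noncomputable def lowSum : Polynomial ℚ →ₗ[ℚ] ℚ :=
  Polynomial.lcoeff ℚ 0 + Polynomial.lcoeff ℚ 1

theorem lowSum_apply (q : Polynomial ℚ) : lowSum q = q.coeff 0 + q.coeff 1 := rfl

open Classical in
theorem sqfreeSum_monomial (m : W →₀ ℕ) :
    sqfreeSum (MvPolynomial.monomial m 1) = if ∀ v, m v ≤ 1 then 1 else 0 := by
  have := (MvPolynomial.basisMonomials W ℚ).constr_basis ℚ
    (fun m : W →₀ ℕ => if ∀ v, m v ≤ 1 then (1 : ℚ) else 0) m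
  rw [MvPolynomial.coe_basisMonomials] at this
  exact this

theorem sum_range_lowSum (q : Polynomial ℚ) {N : ℕ} (hN : 2 ≤ N) :
    ∑ k ∈ range N, q.coeff k * (if k ≤ 1 then 1 else 0) = lowSum q := by
  obtain ⟨M, rfl⟩ := Nat.exists_eq_add_of_le hN
  rw [sum_range_add, lowSum_apply]
  rw [sum_eq_zero (s := range M)]
  · simp [sum_range_succ]
  · intro k _
    rw [if_neg (by omega), mul_zero]

/-- Being square-free is a condition on each variable separately, so the evaluation of a product of
univariate polynomials factors. -/
theorem sqfreeSum_prod_aeval (g : W → Polynomial ℚ) :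
    sqfreeSum (∏ v, Polynomial.aeval (MvPolynomial.X v : MvPolynomial W ℚ) (g v)) =
      ∏ v, lowSum (g v) := by
  classical
  obtain ⟨N, hN2, hN⟩ : ∃ N, 2 ≤ N ∧ ∀ v, (g v).natDegree < N :=
    ⟨univ.sup (fun v => (g v).natDegree) + 2, by omega, fun v => by
      have := Finset.le_sup (f := fun v => (g v).natDegree) (mem_univ v)
      omega⟩
  calc _ = sqfreeSum (∑ x ∈ Fintype.piFinset (fun _ : W => range N),
        (∏ v, (g v).coeff (x v)) •
          MvPolynomial.monomial (Finsupp.equivFunOnFinite.symm x) (1 : ℚ)) := by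
        refine congrArg sqfreeSum ?_
        rw [prod_congr rfl fun v _ => Polynomial.aeval_eq_sum_range' (hN v) _, prod_univ_sum]
        refine sum_congr rfl fun x _ => ?_
        rw [MvPolynomial.monomial_eq, Finsupp.prod_fintype _ _ (by simp)]
        simp [MvPolynomial.smul_eq_C_mul, prod_mul_distrib]
    _ = ∏ v, ∑ k ∈ range N, (g v).coeff k * (if k ≤ 1 then 1 else 0) := by
        rw [map_sum, prod_univ_sum]
        refine sum_congr rfl fun x _ => ?_
        rw [map_smul, sqfreeSum_monomial, prod_mul_distrib, smul_eq_mul]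
        congr 1
        rw [prod_ite_zero]
        simp
    _ = _ := prod_congr rfl fun v _ => sum_range_lowSum _ hN2

/-- The polynomial `X_u + X_v - X_u X_v` of an edge `uv`. -/
noncomputable def edgePoly (e : Sym2 W) : MvPolynomial W ℚ :=
  Sym2.lift ⟨fun u v => MvPolynomial.X u + MvPolynomial.X v - MvPolynomial.X u * MvPolynomial.X v,
    fun u v => by ring⟩ e

theorem edgePoly_mk (u v : W) : edgePoly s(u, v) =
    (MvPolynomial.X u + MvPolynomial.X v - MvPolynomial.X u * MvPolynomial.X v :
      MvPolynomial W ℚ) := rfl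

/-- The univariate polynomials `g v` substituted into the variables `X_v`. -/
noncomputable def vertexPoly (g : W → Polynomial ℚ) : MvPolynomial W ℚ :=
  ∏ v, Polynomial.aeval (MvPolynomial.X v : MvPolynomial W ℚ) (g v)

theorem vertexPoly_mul (g h : W → Polynomial ℚ) :
    vertexPoly (g * h) = vertexPoly g * vertexPoly h := by
  simp [vertexPoly, prod_mul_distrib]

theorem vertexPoly_mulSingle [DecidableEq W] (u : W) (q : Polynomial ℚ) :
    vertexPoly (Pi.mulSingle u q) =
      Polynomial.aeval (MvPolynomial.X u : MvPolynomial W ℚ) q := by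
  rw [vertexPoly, prod_eq_single u]
  · simp
  · intro v _ hv
    simp [Pi.mulSingle_eq_of_ne hv]
  · simp

theorem prod_mul_mulSingle_of_mem [DecidableEq W] (g : W → Polynomial ℚ) {u : W} (q : Polynomial ℚ)
    {C : Finset W} (hu : u ∈ C) :
    ∏ v ∈ C, (g * Pi.mulSingle u q : W → Polynomial ℚ) v = (∏ v ∈ C, g v) * q := by
  simp only [Pi.mul_apply, prod_mul_distrib]
  congr 1
  rw [prod_eq_single u]
  · simp
  · intro v _ hv
    simp [Pi.mulSingle_eq_of_ne hv]
  · exact fun h => (h hu).elim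

theorem prod_mul_mulSingle_of_notMem [DecidableEq W] (g : W → Polynomial ℚ) {u : W}
    (q : Polynomial ℚ) {C : Finset W} (hu : u ∉ C) :
    ∏ v ∈ C, (g * Pi.mulSingle u q : W → Polynomial ℚ) v = ∏ v ∈ C, g v := by
  refine prod_congr rfl fun v hv => ?_
  have : v ≠ u := fun h => hu (h ▸ hv)
  simp [Pi.mulSingle_eq_of_ne this]

/-- The square-free evaluation over a forest factors over its connected components. -/
theorem sqfreeSum_forest [DecidableEq W] (S : Finset (Sym2 W)) (hdiag : ∀ e ∈ S, ¬ e.IsDiag)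
    (hS : (fromEdgeSet (S : Set (Sym2 W))).IsAcyclic) (g : W → Polynomial ℚ) :
    sqfreeSum (vertexPoly g * ∏ e ∈ S, edgePoly e) =
      ∏ C ∈ blocks S, lowSum (∏ v ∈ C, g v) := by
  induction S using Finset.induction_on generalizing g with
  | empty =>
    rw [prod_blocks_empty, prod_empty, mul_one, vertexPoly, sqfreeSum_prod_aeval]
    simp
  | @insert e S he ih =>
    induction e using Sym2.ind with
    | _ u v =>
    have hne : u ≠ v := by simpa using hdiag s(u, v) (mem_insert_self _ _)
    have hacy : (fromEdgeSet (S : Set (Sym2 W))).IsAcyclic :=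
      hS.anti (fromEdgeSet_mono (by simp))
    replace ih := ih (fun e he => hdiag e (mem_insert_of_mem he)) hacy
    -- In a forest every edge is a bridge, so its ends are not already connected by the other edges.
    have huv : blockOf S u ≠ blockOf S v := by
      intro h
      rw [blockOf_eq_iff] at h
      have hb := (isAcyclic_iff_forall_isBridge.1 hS)
        (e := s(u, v)) (by simp [hne])
      rw [isBridge_iff] at hb
      refine hb (h.mono ?_)
      intro x y hxy
      rw [fromEdgeSet_adj] at hxy
      rw [deleteEdges_adj, fromEdgeSet_adj]
      refine ⟨⟨by simp [hxy.1], hxy.2⟩, fun h => he ?_⟩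
      rw [Set.mem_singleton_iff] at h
      rw [← h]; exact hxy.1
    obtain ⟨T, hT, hprod⟩ := exists_blocks_insert huv
    have hdu : v ∉ blockOf S u := fun h =>
      huv (eq_blockOf (blockOf_mem_blocks S u) h)
    have hdv : u ∉ blockOf S v := fun h =>
      huv (eq_blockOf (blockOf_mem_blocks S v) h).symm
    have hdisj : Disjoint (blockOf S u) (blockOf S v) :=
      pairwiseDisjoint_blocks S (blockOf_mem_blocks S u) (blockOf_mem_blocks S v) huv
    have hr : ∀ (a b : Polynomial ℚ),
        ∏ C ∈ T, lowSum (∏ w ∈ C, (g * Pi.mulSingle u a * Pi.mulSingle v b : W → Polynomial ℚ) w) =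
          ∏ C ∈ T, lowSum (∏ w ∈ C, g w) := by
      intro a b
      refine prod_congr rfl fun C hC => ?_
      rw [prod_mul_mulSingle_of_notMem _ _ (hT C hC).2,
        prod_mul_mulSingle_of_notMem _ _ (hT C hC).1]
    have hval : ∀ (a b : Polynomial ℚ),
        sqfreeSum (vertexPoly g * Polynomial.aeval (MvPolynomial.X u) a *
          Polynomial.aeval (MvPolynomial.X v) b * ∏ e ∈ S, edgePoly e) =
        lowSum ((∏ w ∈ blockOf S u, g w) * a) * lowSum ((∏ w ∈ blockOf S v, g w) * b) *
          ∏ C ∈ T, lowSum (∏ w ∈ C, g w) := by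
      intro a b
      rw [← vertexPoly_mulSingle, ← vertexPoly_mulSingle, ← vertexPoly_mul, ← vertexPoly_mul, ih,
        (hprod _).1, hr, prod_mul_mulSingle_of_notMem _ _ hdu,
        prod_mul_mulSingle_of_mem _ _ (self_mem_blockOf S u),
        prod_mul_mulSingle_of_mem _ _ (self_mem_blockOf S v),
        prod_mul_mulSingle_of_notMem _ _ hdv]
    rw [prod_insert he, edgePoly_mk, (hprod _).2, prod_union hdisj]
    -- With `A`, `B` the products over the two blocks, the claim becomes `L(XA) L(B) + L(A) L(XB) -
    -- L(XA) L(XB) = L(AB)`. Both sides are `A_0 B_0 + A_0 B_1 + A_1 B_0`.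
    have e1 : vertexPoly g * ((MvPolynomial.X u + MvPolynomial.X v -
        MvPolynomial.X u * MvPolynomial.X v) * ∏ e ∈ S, edgePoly e) =
        vertexPoly g * Polynomial.aeval (MvPolynomial.X u) (Polynomial.X : Polynomial ℚ) *
          Polynomial.aeval (MvPolynomial.X v) (1 : Polynomial ℚ) * ∏ e ∈ S, edgePoly e +
        vertexPoly g * Polynomial.aeval (MvPolynomial.X u) (1 : Polynomial ℚ) *
          Polynomial.aeval (MvPolynomial.X v) (Polynomial.X : Polynomial ℚ) * ∏ e ∈ S, edgePoly e -
        vertexPoly g * Polynomial.aeval (MvPolynomial.X u) (Polynomial.X : Polynomial ℚ) *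
          Polynomial.aeval (MvPolynomial.X v) (Polynomial.X : Polynomial ℚ) *
            ∏ e ∈ S, edgePoly e := by
      simp only [Polynomial.aeval_X, map_one]
      ring
    rw [e1, map_sub, map_add, hval, hval, hval]
    simp only [lowSum_apply, Polynomial.mul_coeff_zero,
      Polynomial.mul_coeff_one, mul_one]
    simp
    ring

end SquareFree


/-! ### Signed sums over edge subsets of a graph with one cycle -/

section SignedSum

variable {W : Type*} [Fintype W] [DecidableEq W]

theorem prod_one_sub_eq_sum_powerset {ι R : Type*} [CommRing R] (E : Finset ι) (f : ι → R) :
    ∏ e ∈ E, (1 - f e) = ∑ S ∈ E.powerset, (-1) ^ #S * ∏ e ∈ S, f e := by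
  have := prod_one_add E (f := fun e => - f e)
  simp only [← sub_eq_add_neg, prod_neg] at this
  exact this

/-- The factorization `(1 - X_u)(1 - X_v)` is what lets a signed sum over edge sets become a product
over vertices. -/
theorem one_sub_edgePoly {e : Sym2 W} (he : ¬ e.IsDiag) :
    1 - edgePoly e = ∏ w, if w ∈ e then (1 - MvPolynomial.X w : MvPolynomial W ℚ) else 1 := by
  induction e using Sym2.ind with
  | _ u v =>
  have hne : u ≠ v := by simpa using he
  rw [prod_ite, prod_const_one, mul_one]
  have : (univ.filter fun w => w ∈ s(u, v)) = {u, v} := by ext; simp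
  rw [this, prod_pair hne, edgePoly_mk]
  ring

theorem prod_one_sub_edgePoly {E : Finset (Sym2 W)} (hE : ∀ e ∈ E, ¬ e.IsDiag) :
    ∏ e ∈ E, (1 - edgePoly e) =
      vertexPoly fun v => (1 - Polynomial.X) ^ #{e ∈ E | v ∈ e} := by
  rw [prod_congr rfl fun e he => one_sub_edgePoly (hE e he), prod_comm, vertexPoly]
  refine prod_congr rfl fun v _ => ?_
  rw [prod_ite, prod_const_one, mul_one, prod_const]
  simp

theorem sum_powerset_mul_prod {ι R : Type*} [CommRing R] (E : Finset ι) (f : ι → R) (P : R) :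
    ∑ S ∈ E.powerset, (-1) ^ #S * (P * ∏ e ∈ S, f e) = P * ∏ e ∈ E, (1 - f e) := by
  rw [prod_one_sub_eq_sum_powerset, mul_sum]
  exact sum_congr rfl fun S _ => by ring

theorem vertexPoly_mul_prod_one_sub {E : Finset (Sym2 W)} (hE : ∀ e ∈ E, ¬ e.IsDiag)
    (g : W → Polynomial ℚ) :
    vertexPoly g * ∏ e ∈ E, (1 - edgePoly e) =
      vertexPoly fun v => g v * (1 - Polynomial.X) ^ #{e ∈ E | v ∈ e} := by
  rw [prod_one_sub_edgePoly hE, ← vertexPoly_mul]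
  rfl

theorem blocks_insert_of_blockOf_eq {S : Finset (Sym2 W)} {a b : W}
    (h : blockOf S a = blockOf S b) : blocks (insert s(a, b) S) = blocks S := by
  have : ∀ x, blockOf (insert s(a, b) S) x = blockOf S x := by
    intro x
    ext y
    rw [mem_blockOf_insert, mem_blockOf, ← blockOf_eq_iff]
    have e : ∀ z, (if blockOf S z = blockOf S b then blockOf S a else blockOf S z) =
        blockOf S z := by
      intro z
      split_ifs with hz
      · rw [hz, h]
      · rfl
    rw [e, e]
  ext C
  simp only [mem_blocks, this]

theorem blockOf_mono {S T : Finset (Sym2 W)} (h : S ⊆ T) {a b : W}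
    (hab : blockOf S a = blockOf S b) : blockOf T a = blockOf T b :=
  blockOf_eq_iff.2 ((blockOf_eq_iff.1 hab).mono (fromEdgeSet_mono (by exact_mod_cast h)))

/-- The signed sum over all edge subsets of a graph with a single cycle `cyc` on the vertices `K`,
weighting every connected component `C` by `lowSum (∏ v ∈ C, g v)`. -/
theorem signed_sum_unicyclic {E cyc : Finset (Sym2 W)} {a b : W} {K : Finset W}
    (hE : ∀ e ∈ E, ¬ e.IsDiag) (hcyc : cyc ⊆ E) (hab : s(a, b) ∈ cyc)
    (hacy : ∀ S ⊆ E, ¬ cyc ⊆ S → (fromEdgeSet (S : Set (Sym2 W))).IsAcyclic)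
    (ha : a ∈ K) (hb : b ∈ K)
    (hK : ∀ v ∈ K, blockOf (cyc.erase s(a, b)) v = K)
    (hK' : ∀ v ∉ K, blockOf (cyc.erase s(a, b)) v = {v})
    (g : W → Polynomial ℚ) :
    ∑ S ∈ E.powerset, (-1) ^ #S * ∏ C ∈ blocks S, lowSum (∏ v ∈ C, g v) =
      ∏ v, lowSum (g v * (1 - Polynomial.X) ^ #{e ∈ E | v ∈ e}) +
      (-1) ^ #cyc * (lowSum ((1 - Polynomial.X) ^ 2 *
          ∏ v ∈ K, (g v * (1 - Polynomial.X) ^ #{e ∈ E \ cyc | v ∈ e})) *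
        ∏ v ∈ Kᶜ, lowSum (g v * (1 - Polynomial.X) ^ #{e ∈ E \ cyc | v ∈ e})) := by
  have hne : a ≠ b := by simpa using hE _ (hcyc hab)
  -- If `S` contains the cycle, deleting `ab` leaves a forest with the same blocks. Replacing its
  -- edge product by that of `S` costs a correction with factor `1 - edgePoly s(a, b)`.
  have hterm : ∀ S ∈ E.powerset, (-1 : ℚ) ^ #S * ∏ C ∈ blocks S, lowSum (∏ v ∈ C, g v) =
      (-1) ^ #S * sqfreeSum (vertexPoly g * ∏ e ∈ S, edgePoly e) +
      if cyc ⊆ S then (-1) ^ #S * sqfreeSum (vertexPoly g * (1 - edgePoly s(a, b)) *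
        ∏ e ∈ S.erase s(a, b), edgePoly e) else 0 := by
    intro S hS
    rw [mem_powerset] at hS
    split_ifs with h
    · have h1 : blocks S = blocks (S.erase s(a, b)) := by
        conv_lhs => rw [← insert_erase (h hab)]
        exact blocks_insert_of_blockOf_eq (blockOf_mono (erase_subset_erase _ h)
          ((hK a ha).trans (hK b hb).symm))
      have h2 : (fromEdgeSet ((S.erase s(a, b) : Finset (Sym2 W)) : Set (Sym2 W))).IsAcyclic :=
        hacy _ ((erase_subset _ _).trans hS) fun h => notMem_erase _ _ (h hab)
      rw [h1, ← sqfreeSum_forest _ (fun e he => hE e (hS (erase_subset _ _ he))) h2,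
        ← mul_prod_erase S _ (h hab), ← mul_add, ← map_add]
      congr 2
      ring
    · rw [add_zero, sqfreeSum_forest _ (fun e he => hE e (hS he)) (hacy S hS h)]
  have hsign : ∀ (n : ℕ) (q : MvPolynomial W ℚ),
      (-1 : ℚ) ^ n * sqfreeSum q = sqfreeSum ((-1) ^ n * q) := by
    intro n q
    rcases neg_one_pow_eq_or ℚ n with h | h <;>
      rcases Nat.even_or_odd n with h' | h' <;> simp [h'.neg_one_pow]
  rw [sum_congr rfl hterm, sum_add_distrib]
  congr 1
  · simp only [hsign]
    rw [← map_sum]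
    rw [sum_powerset_mul_prod, vertexPoly_mul_prod_one_sub hE, vertexPoly, sqfreeSum_prod_aeval]
  · rw [← sum_filter]
    have h1 : (E.powerset.filter fun S => cyc ⊆ S) = (E \ cyc).powerset.image (cyc ∪ ·) := by
      rw [← Icc_eq_image_powerset hcyc]
      ext S
      simp [and_comm]
    have hinj : ∀ S ∈ (E \ cyc).powerset, ∀ T ∈ (E \ cyc).powerset,
        cyc ∪ S = cyc ∪ T → S = T := by
      intro S hS T hT h
      rw [mem_powerset, subset_sdiff] at hS hT
      rw [← union_sdiff_cancel_left hS.2.symm, h, union_sdiff_cancel_left hT.2.symm]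
    rw [h1, sum_image hinj]
    have h3 : ∀ S ∈ (E \ cyc).powerset, (-1 : ℚ) ^ #(cyc ∪ S) *
        sqfreeSum (vertexPoly g * (1 - edgePoly s(a, b)) *
          ∏ e ∈ (cyc ∪ S).erase s(a, b), edgePoly e) =
        (-1) ^ #cyc * sqfreeSum ((-1) ^ #S * (vertexPoly g * (1 - edgePoly s(a, b)) *
          (∏ e ∈ cyc.erase s(a, b), edgePoly e) * ∏ e ∈ S, edgePoly e)) := by
      intro S hS
      rw [mem_powerset, subset_sdiff] at hS
      have hn : s(a, b) ∉ S := fun h => Finset.disjoint_left.1 hS.2 h hab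
      rw [card_union_of_disjoint hS.2.symm, ← hsign, erase_union_distrib, erase_eq_of_notMem hn,
        prod_union (hS.2.symm.mono_left (erase_subset _ _))]
      ring_nf
    rw [sum_congr rfl h3, ← mul_sum, ← map_sum]
    congr 1
    set h : W → Polynomial ℚ := fun v => g v * (1 - Polynomial.X) ^ #{e ∈ E \ cyc | v ∈ e} with hh
    -- The edges off the cycle collapse into vertex factors. The factor `1 - edgePoly s(a, b)` adds
    -- `1 - X` at both `a` and `b`; both lie in the block `K`, whence the square in the statement.
    have h4 : ∑ S ∈ (E \ cyc).powerset, (-1) ^ #S * (vertexPoly g * (1 - edgePoly s(a, b)) *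
          (∏ e ∈ cyc.erase s(a, b), edgePoly e) * ∏ e ∈ S, edgePoly e) =
        vertexPoly (h * Pi.mulSingle a (1 - Polynomial.X) * Pi.mulSingle b (1 - Polynomial.X)) *
          ∏ e ∈ cyc.erase s(a, b), edgePoly e := by
      rw [sum_powerset_mul_prod, vertexPoly_mul, vertexPoly_mul, vertexPoly_mulSingle,
        vertexPoly_mulSingle, hh,
        ← vertexPoly_mul_prod_one_sub (fun e he => hE e (sdiff_subset he)), edgePoly_mk]
      simp only [map_sub, map_one, Polynomial.aeval_X]
      ring
    rw [h4, sqfreeSum_forest _ (fun e he => hE e (hcyc (erase_subset _ _ he)))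
      (hacy _ ((erase_subset _ _).trans hcyc) fun h => notMem_erase _ _ (h hab))]
    have h5 : blocks (cyc.erase s(a, b)) = insert K (Kᶜ.image fun v => {v}) := by
      ext C
      simp only [mem_blocks, mem_insert, mem_image, mem_compl]
      constructor
      · rintro ⟨v, rfl⟩
        by_cases hv : v ∈ K
        · exact Or.inl (hK v hv)
        · exact Or.inr ⟨v, hv, (hK' v hv).symm⟩
      · rintro (rfl | ⟨v, hv, rfl⟩)
        · exact ⟨a, hK a ha⟩
        · exact ⟨v, hK' v hv⟩
    rw [h5, prod_insert, prod_image (fun x _ y _ hxy => Finset.singleton_injective hxy),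
      prod_mul_mulSingle_of_mem _ _ hb, prod_mul_mulSingle_of_mem _ _ ha]
    · congr 1
      · congr 1
        ring
      · refine prod_congr rfl fun v hv => ?_
        rw [mem_compl] at hv
        rw [prod_mul_mulSingle_of_notMem _ _ (by simpa using fun h : b = v => hv (h ▸ hb)),
          prod_mul_mulSingle_of_notMem _ _ (by simpa using fun h : a = v => hv (h ▸ ha)),
          prod_singleton]
    · simp only [mem_image, mem_compl, not_exists, not_and]
      intro v hv h
      exact hv (by rw [← h]; simp)

end SignedSum


/-! ### From weighted sums to counts of admissible edge sets -/

section SignedCount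

theorem coeff_one_sub_X_pow_zero_one (d : ℕ) :
    ((1 - Polynomial.X : Polynomial ℚ) ^ d).coeff 0 = 1 ∧
      ((1 - Polynomial.X : Polynomial ℚ) ^ d).coeff 1 = -d := by
  induction d with
  | zero => simp [Polynomial.coeff_one]
  | succ d ih =>
    rw [pow_succ, Polynomial.mul_coeff_zero, Polynomial.mul_coeff_one, ih.1, ih.2]
    simp [Polynomial.coeff_one]

theorem lowSum_one_sub_X_pow (d : ℕ) : lowSum ((1 - Polynomial.X) ^ d) = 1 - d := by
  rw [lowSum_apply, (coeff_one_sub_X_pow_zero_one d).1, (coeff_one_sub_X_pow_zero_one d).2]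
  ring

theorem lowSum_X_mul_one_sub_X_pow (d : ℕ) :
    lowSum (Polynomial.X * (1 - Polynomial.X) ^ d) = 1 := by
  rw [lowSum_apply, Polynomial.mul_coeff_zero, Polynomial.mul_coeff_one,
    (coeff_one_sub_X_pow_zero_one d).1, (coeff_one_sub_X_pow_zero_one d).2]
  simp

theorem lowSum_X_pow_mul (k : ℕ) (hk : 2 ≤ k) (q : Polynomial ℚ) :
    lowSum (Polynomial.X ^ k * q) = 0 := by
  rw [lowSum_apply, Polynomial.coeff_X_pow_mul', Polynomial.coeff_X_pow_mul', if_neg (by omega),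
    if_neg (by omega), add_zero]

theorem lowSum_X_pow (k : ℕ) : lowSum (Polynomial.X ^ k) = if k ≤ 1 then 1 else 0 := by
  rcases k with _ | _ | k
  · simp [lowSum_apply, Polynomial.coeff_one]
  · simp [lowSum_apply]
  · rw [if_neg (by omega), ← mul_one (Polynomial.X ^ _), lowSum_X_pow_mul _ (by omega)]

variable {W : Type*} [Fintype W] [DecidableEq W]

theorem prod_ite_mem_X (C N : Finset W) :
    ∏ v ∈ C, (if v ∈ N then Polynomial.X else 1 : Polynomial ℚ) = Polynomial.X ^ #(C ∩ N) := by
  rw [prod_ite, prod_const_one, mul_one, prod_const, filter_mem_eq_inter]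

/-- The signed number of edge sets none of whose connected components contains two vertices of `N`,
for a graph with a single cycle `cyc` on the vertices `K`. -/
theorem signed_count_unicyclic {E cyc : Finset (Sym2 W)} {a b : W} {K : Finset W}
    (hE : ∀ e ∈ E, ¬ e.IsDiag) (hcyc : cyc ⊆ E) (hab : s(a, b) ∈ cyc)
    (hacy : ∀ S ⊆ E, ¬ cyc ⊆ S → (fromEdgeSet (S : Set (Sym2 W))).IsAcyclic)
    (ha : a ∈ K) (hb : b ∈ K)
    (hK : ∀ v ∈ K, blockOf (cyc.erase s(a, b)) v = K)
    (hK' : ∀ v ∉ K, blockOf (cyc.erase s(a, b)) v = {v}) (N : Finset W) :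
    ∑ S ∈ E.powerset, (-1 : ℚ) ^ #S * (if ∀ C ∈ blocks S, #(C ∩ N) ≤ 1 then 1 else 0) =
      ∏ v ∈ Nᶜ, (1 - (#{e ∈ E | v ∈ e} : ℚ)) +
      (-1) ^ #cyc * ((if #(K ∩ N) = 0 then - 1 - ∑ v ∈ K, (#{e ∈ E \ cyc | v ∈ e} : ℚ)
        else if #(K ∩ N) = 1 then 1 else 0) *
        ∏ v ∈ Kᶜ \ N, (1 - (#{e ∈ E \ cyc | v ∈ e} : ℚ))) := by
  -- With these weights a block `C` contributes `L(X^#(C ∩ N))`, the indicator of `#(C ∩ N) ≤ 1`.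
  have h := signed_sum_unicyclic hE hcyc hab hacy ha hb hK hK'
    (fun v => if v ∈ N then Polynomial.X else 1)
  have hlow : ∀ (v : W) (d : ℕ), lowSum ((if v ∈ N then Polynomial.X else 1) *
      (1 - Polynomial.X) ^ d) = if v ∈ N then 1 else 1 - (d : ℚ) := by
    intro v d
    split_ifs
    · exact lowSum_X_mul_one_sub_X_pow d
    · rw [one_mul, lowSum_one_sub_X_pow]
  have hprod : ∀ (T : Finset W) (f : W → ℚ),
      ∏ v ∈ T, (if v ∈ N then 1 else f v) = ∏ v ∈ T \ N, f v := by
    intro T f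
    rw [prod_ite, prod_const_one, one_mul, sdiff_eq_filter]
  simp only [prod_ite_mem_X, lowSum_X_pow, hlow, hprod, prod_ite_zero, prod_const_one] at h
  rw [h, compl_eq_univ_sdiff]
  congr 4
  -- The block `K` carries `X^#(K ∩ N) (1 - X)^(2 + ∑)`. Its low sum is `1 - (2 + ∑)`, `1` or `0`
  -- according as `#(K ∩ N)` is `0`, `1` or more.
  rw [prod_mul_distrib, prod_ite_mem_X, prod_pow_eq_pow_sum, mul_left_comm, ← pow_add]
  split_ifs with h0 h1
  · rw [h0, pow_zero, one_mul, lowSum_one_sub_X_pow]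
    push_cast
    ring
  · rw [h1, pow_one, lowSum_X_mul_one_sub_X_pow]
  · exact lowSum_X_pow_mul _ (by omega) _

end SignedCount


/-! ### Combinatorial data of the unique cycle -/

section Unicyclic

variable {V : Type*} [Fintype V] [DecidableEq V] {G : SimpleGraph V} [DecidableRel G.Adj]

/-- This supplies the hypotheses of `signed_count_unicyclic`: `ab` is the first edge of a walk
around the cycle, and the rest of the walk is a path through all of `K`. -/
theorem IsUnicyclic.exists_cycle (huni : G.IsUnicyclic) :
    ∃ (cyc : Finset (Sym2 V)) (K : Finset V) (a b : V),
      (K : Set V) = G.cycleVerts ∧ (cyc : Set (Sym2 V)) = G.cycleEdges ∧ cyc ⊆ G.edgeFinset ∧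
      s(a, b) ∈ cyc ∧ (∀ e ∈ cyc, ∀ v ∈ e, v ∈ K) ∧ #cyc = #K ∧
      (∀ v ∈ K, #{e ∈ cyc | v ∈ e} = 2) ∧
      (∀ S ⊆ G.edgeFinset, ¬ cyc ⊆ S → (fromEdgeSet (S : Set (Sym2 V))).IsAcyclic) ∧
      (∀ v ∈ K, blockOf (cyc.erase s(a, b)) v = K) ∧
      (∀ v ∉ K, blockOf (cyc.erase s(a, b)) v = {v}) := by
  obtain ⟨C, ⟨a, w, hw, rfl⟩, huniq⟩ := huni
  have hC : ∀ D, G.IsCycleSubgraph D ↔ D = w.toSubgraph := fun D =>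
    ⟨huniq D, fun h => h ▸ ⟨a, w, hw, rfl⟩⟩
  cases w with
  | nil => exact absurd hw (by simp)
  | @cons _ b _ hadj q =>
  set w := Walk.cons hadj q with hwdef
  have hmemK : ∀ e ∈ w.edges.toFinset, ∀ v ∈ e, v ∈ w.support.toFinset := by
    intro e he v hv
    rw [List.mem_toFinset] at *
    exact w.mem_support_of_mem_edges he hv
  have hsup : w.support.toFinset = q.support.toFinset := by
    ext v
    rw [List.mem_toFinset, List.mem_toFinset, hwdef, Walk.support_cons, List.mem_cons]
    exact ⟨fun h => h.elim (fun h => h ▸ q.end_mem_support) id, Or.inr⟩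
  have hnotq : s(a, b) ∉ q.edges := by
    have := hw.edges_nodup
    rw [hwdef, Walk.edges_cons, List.nodup_cons] at this
    exact this.1
  have herase : w.edges.toFinset.erase s(a, b) = q.edges.toFinset := by
    ext e
    rw [mem_erase, List.mem_toFinset, List.mem_toFinset, hwdef, Walk.edges_cons, List.mem_cons]
    constructor
    · rintro ⟨h1, h2 | h2⟩
      · exact absurd h2 h1
      · exact h2
    · exact fun h => ⟨fun h' => hnotq (h' ▸ h), Or.inr h⟩
  refine ⟨w.edges.toFinset, w.support.toFinset, a, b, ?_, ?_, ?_, ?_, hmemK, ?_, ?_, ?_, ?_, ?_⟩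
  · ext v
    simp [cycleVerts, hC]
  · ext e
    simp [cycleEdges, hC]
  · intro e he
    rw [List.mem_toFinset] at he
    exact mem_edgeFinset.2 (w.edges_subset_edgeSet he)
  · simp [hwdef]
  · rw [List.toFinset_card_of_nodup hw.edges_nodup, hsup, List.toFinset_card_of_nodup]
    · simp [hwdef]
    · have := hw.support_nodup
      simpa [hwdef] using this
  · intro v hv
    -- Cycle edges at `v` correspond to neighbors of `v` in the cycle, of which there are two.
    rw [List.mem_toFinset] at hv
    rw [← hw.ncard_neighborSet_toSubgraph_eq_two hv, ← Set.ncard_coe_finset,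
      ← Set.ncard_image_of_injective (w.toSubgraph.neighborSet v) (f := fun x => s(v, x))
        (fun x y h => Sym2.congr_right.1 h)]
    congr 1
    ext e
    simp only [coe_filter, List.mem_toFinset, Set.mem_ofPred_eq, Set.mem_image,
      Subgraph.mem_neighborSet]
    constructor
    · rintro ⟨he, hve⟩
      obtain ⟨x, rfl⟩ := hve
      exact ⟨x, by rwa [← Subgraph.mem_edgeSet, Walk.mem_edges_toSubgraph], rfl⟩
    · rintro ⟨x, hx, rfl⟩
      rw [← Subgraph.mem_edgeSet, Walk.mem_edges_toSubgraph] at hx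
      exact ⟨hx, by simp⟩
  -- A cycle formed by edges of `S` is a cycle of `G`, hence the unique one, so `S` would contain
  -- `cyc`.
  · intro S hS hn u c hc
    apply hn
    have hle : fromEdgeSet (S : Set (Sym2 V)) ≤ G := by
      intro x y h
      rw [fromEdgeSet_adj] at h
      exact mem_edgeFinset.1 (hS h.1)
    have h1 := (hC _).1 ⟨u, c.mapLe hle, hc.mapLe hle, rfl⟩
    intro e he
    rw [List.mem_toFinset, ← Walk.mem_edges_toSubgraph, ← h1, Walk.mem_edges_toSubgraph,
      Walk.edges_mapLe_eq_edges] at he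
    have := c.edges_subset_edgeSet he
    rw [edgeSet_fromEdgeSet] at this
    exact_mod_cast this.1
  · have hreach : ∀ v ∈ q.support, (fromEdgeSet (q.edges.toFinset : Set (Sym2 V))).Reachable b v := by
      intro v hv
      have hq : ∀ e ∈ (q.takeUntil v hv).edges, e ∈
          (fromEdgeSet (q.edges.toFinset : Set (Sym2 V))).edgeSet := by
        intro e he
        have he' := q.edges_takeUntil_subset_edges hv he
        rw [edgeSet_fromEdgeSet]
        refine ⟨by simpa using he', ?_⟩
        exact G.not_isDiag_of_mem_edgeSet (q.edges_subset_edgeSet he')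
      exact ((q.takeUntil v hv).transfer _ hq).reachable
    intro v hv
    rw [herase]
    rw [hsup, List.mem_toFinset] at hv
    ext x
    rw [mem_blockOf, hsup, List.mem_toFinset]
    constructor
    · intro h
      by_cases hx : x = v
      · rw [hx]; exact hv
      obtain ⟨y, hy⟩ := h.nonempty_neighborSet_right (Ne.symm hx)
      rw [mem_neighborSet, fromEdgeSet_adj] at hy
      exact q.mem_support_of_mem_edges (e := s(x, y)) (by simpa using hy.1) (by simp)
    · exact fun h => (hreach v hv).symm.trans (hreach x h)
  · intro v hv
    rw [herase]
    rw [hsup, List.mem_toFinset] at hv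
    ext x
    rw [mem_blockOf, mem_singleton]
    constructor
    · intro h
      by_contra hx
      obtain ⟨y, hy⟩ := h.nonempty_neighborSet_left (Ne.symm hx)
      rw [mem_neighborSet, fromEdgeSet_adj] at hy
      exact hv (q.mem_support_of_mem_edges (e := s(v, y)) (by simpa using hy.1) (by simp))
    · rintro rfl
      exact Reachable.refl _

end Unicyclic


/-! ### Evaluating the signed count in terms of deep vertices and sprouts -/

section UnicyclicCount

variable {V : Type*} [Fintype V] [DecidableEq V] (G : SimpleGraph V) [DecidableRel G.Adj]

/-- The edges between vertices of degree at least two. -/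
def internalEdges : Finset (Sym2 V) := {e ∈ G.edgeFinset | ∀ v ∈ e, 2 ≤ G.degree v}

/-- The vertices of degree at least two that have an adjacent leaf. -/
def leafSupports : Finset V := {v | 2 ≤ G.degree v ∧ ∃ w, G.Adj v w ∧ G.degree w = 1}

variable {G}

theorem mem_internalEdges {u v : V} : s(u, v) ∈ G.internalEdges ↔
    G.Adj u v ∧ 2 ≤ G.degree u ∧ 2 ≤ G.degree v := by
  simp [internalEdges]

theorem mem_leafSupports {v : V} : v ∈ G.leafSupports ↔
    2 ≤ G.degree v ∧ ∃ w, G.Adj v w ∧ G.degree w = 1 := by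
  simp [leafSupports]

/-- A neighbor of a deep vertex has positive degree and is not a leaf, so every edge at the vertex
is internal. -/
theorem IsDeep.card_internalEdges {v : V} (hv : G.IsDeep v) :
    #{e ∈ G.internalEdges | v ∈ e} = G.degree v := by
  rw [← card_incidenceFinset_eq_degree]
  congr 1
  ext e
  induction e using Sym2.ind with
  | _ x y =>
  simp only [mem_filter, mem_internalEdges, mem_incidenceFinset, mk'_mem_incidenceSet_iff,
    Sym2.mem_iff]
  have key : ∀ w, G.Adj v w → 2 ≤ G.degree w := by
    intro w hw
    have h1 := hv.2 w hw
    have h2 : 0 < G.degree w := (G.degree_pos_iff_exists_adj w).2 ⟨v, hw.symm⟩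
    rw [IsLeafVert] at h1
    omega
  constructor
  · rintro ⟨⟨h1, -, -⟩, h2⟩
    exact ⟨h1, h2⟩
  · rintro ⟨h, rfl | rfl⟩
    · exact ⟨⟨h, hv.1, key _ h⟩, Or.inl rfl⟩
    · exact ⟨⟨h, key _ h.symm, hv.1⟩, Or.inr rfl⟩

theorem card_internalEdges_of_degree_lt {v : V} (hv : G.degree v < 2) :
    #{e ∈ G.internalEdges | v ∈ e} = 0 := by
  rw [card_eq_zero, filter_eq_empty_iff]
  intro e he h
  have := (mem_filter.1 he).2 v h
  omega

theorem isDeep_or_of_notMem_leafSupports {v : V} (hv : v ∉ G.leafSupports) :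
    G.IsDeep v ∨ G.degree v < 2 := by
  by_cases h : 2 ≤ G.degree v
  · refine Or.inl ⟨h, fun w hw hl => hv (mem_leafSupports.2 ⟨h, w, hw, hl⟩)⟩
  · exact Or.inr (by omega)

theorem IsDeep.notMem_leafSupports {v : V} (hv : G.IsDeep v) : v ∉ G.leafSupports := by
  rw [mem_leafSupports]
  rintro ⟨-, w, hw, h⟩
  exact hv.2 w hw h

theorem mem_sprouts {v : V} : v ∈ G.sprouts ↔ G.IsSprout v := by
  simp [sprouts]

theorem mem_nonSproutDeep {v : V} : v ∈ G.nonSproutDeep ↔ G.IsDeep v ∧ ¬ G.IsSprout v := by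
  simp [nonSproutDeep]

open Classical in
theorem prod_deep {M : Type*} [CommMonoid M] (f : V → M) :
    ∏ v with G.IsDeep v, f v = (∏ v ∈ G.nonSproutDeep, f v) * ∏ v ∈ G.sprouts, f v := by
  rw [← prod_filter_mul_prod_filter_not (univ.filter G.IsDeep) G.IsSprout, mul_comm]
  congr 1
  · refine prod_congr ?_ fun _ _ => rfl
    ext v
    simp [mem_nonSproutDeep]
  · refine prod_congr ?_ fun _ _ => rfl
    ext v
    simp only [mem_filter, mem_sprouts, mem_univ, true_and]
    exact ⟨fun h => h.2, fun h => ⟨h.1, h⟩⟩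

theorem prod_one_sub_eq {ι : Type*} (s : Finset ι) (d : ι → ℚ) :
    ∏ i ∈ s, (1 - d i) = (-1) ^ #s * ∏ i ∈ s, (d i - 1) := by
  rw [← prod_neg]
  simp

/-- Exactly two edges at a cycle vertex lie on the cycle, so its tree is nontrivial precisely when
there is a third edge. -/
theorem mem_nontrivialRoots_iff {cyc : Finset (Sym2 V)} {K : Finset V}
    (hK : (K : Set V) = G.cycleVerts) (hcyc : (cyc : Set (Sym2 V)) = G.cycleEdges)
    (hsub : cyc ⊆ G.edgeFinset) (hdeg : ∀ v ∈ K, #{e ∈ cyc | v ∈ e} = 2) (v : V) :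
    v ∈ G.nontrivialRoots ↔ v ∈ K ∧ 3 ≤ G.degree v := by
  change v ∈ G.cycleVerts ∧ _ ↔ _
  rw [← hK, mem_coe]
  refine and_congr_right fun hv => ?_
  have hss : {e ∈ cyc | v ∈ e} ⊆ G.incidenceFinset v := by
    intro e he
    rw [mem_filter] at he
    rw [mem_incidenceFinset]
    exact ⟨mem_edgeFinset.1 (hsub he.1), he.2⟩
  have hnb : (∃ x, G.Adj v x ∧ s(v, x) ∉ cyc) ↔ 3 ≤ G.degree v := by
    rw [← card_incidenceFinset_eq_degree]
    constructor
    · rintro ⟨x, hx, hxc⟩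
      have : {e ∈ cyc | v ∈ e} ⊂ G.incidenceFinset v := by
        refine (ssubset_iff_of_subset hss).2 ⟨s(v, x), ?_, ?_⟩
        · rw [mem_incidenceFinset]
          exact ⟨hx, by simp⟩
        · simp [hxc]
      have := card_lt_card this
      rw [hdeg v hv] at this
      exact this
    · intro h
      obtain ⟨e, he, he'⟩ := exists_mem_notMem_of_card_lt_card (s := {e ∈ cyc | v ∈ e})
        (t := G.incidenceFinset v) (by rw [hdeg v hv]; omega)
      rw [mem_incidenceFinset] at he
      obtain ⟨h1, x, rfl⟩ := he
      exact ⟨x, h1, fun h2 => he' (by simp [h2])⟩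
  rw [← hnb, rootedTreeVerts, ← hcyc]
  constructor
  · intro h
    obtain ⟨x, hx, hxv⟩ := h.exists_ne v
    have hr : (G.deleteEdges (cyc : Set (Sym2 V))).Reachable v x := by
      rw [ConnectedComponent.mem_supp_iff, ConnectedComponent.eq] at hx
      exact hx.symm
    obtain ⟨y, hy⟩ := hr.nonempty_neighborSet_left hxv.symm
    rw [mem_neighborSet, deleteEdges_adj] at hy
    exact ⟨y, hy.1, by simpa using hy.2⟩
  · rintro ⟨x, hx, hxc⟩
    refine ⟨v, ConnectedComponent.connectedComponentMk_mem, x, ?_, hx.ne⟩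
    rw [ConnectedComponent.mem_supp_iff, ConnectedComponent.eq]
    exact (Adj.reachable (by rw [deleteEdges_adj]; exact ⟨hx, by simpa using hxc⟩)).symm

/-- The signed number of sets of internal edges none of whose connected components contains two
vertices with adjacent leaves. -/
theorem IsUnicyclic.signed_count (huni : G.IsUnicyclic) {r s p : ℕ}
    (hr : G.nontrivialRoots.ncard = r) (hs : G.sprouts.card = s)
    (hp : G.nonSproutDeep.card = p) :
    ∑ S ∈ G.internalEdges.powerset, (-1 : ℚ) ^ #S *
      (if ∀ C ∈ blocks S, #(C ∩ G.leafSupports) ≤ 1 then 1 else 0) =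
    (-1) ^ (p + s) *
      ((∏ u ∈ G.nonSproutDeep, ((G.degree u : ℚ) - 1)) *
        (if r = s then
          (∏ v ∈ G.sprouts, ((G.degree v : ℚ) - 1)) - (∑ v ∈ G.sprouts, (G.degree v : ℚ))
            + 2 * (s : ℚ) - 1
        else if r = s + 1 then
          (∏ v ∈ G.sprouts, ((G.degree v : ℚ) - 1)) - 1
        else
          ∏ v ∈ G.sprouts, ((G.degree v : ℚ) - 1))) := by
  classical
  obtain ⟨cyc, K, a, b, hKv, hce, hsub, hab, hmem, hcard, hdeg, hacy, hK, hK'⟩ :=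
    huni.exists_cycle
  have hdeg2 : ∀ v ∈ K, 2 ≤ G.degree v := by
    intro v hv
    rw [← hdeg v hv, ← card_incidenceFinset_eq_degree]
    refine card_le_card fun e he => ?_
    rw [mem_filter] at he
    rw [mem_incidenceFinset]
    exact ⟨mem_edgeFinset.1 (hsub he.1), he.2⟩
  have hcycE : cyc ⊆ G.internalEdges := fun e he =>
    mem_filter.2 ⟨hsub he, fun v hv => hdeg2 v (hmem e he v hv)⟩
  have hEsub : G.internalEdges ⊆ G.edgeFinset := filter_subset _ _
  have hspr : ∀ v, G.IsSprout v ↔ G.IsDeep v ∧ v ∈ K ∧ 3 ≤ G.degree v := by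
    intro v
    rw [IsSprout, ← hKv, mem_coe]
  have hncK : ∀ v ∈ K, (#{e ∈ G.internalEdges \ cyc | v ∈ e} : ℚ) =
      #{e ∈ G.internalEdges | v ∈ e} - 2 := by
    intro v hv
    have : {e ∈ G.internalEdges \ cyc | v ∈ e} =
        {e ∈ G.internalEdges | v ∈ e} \ {e ∈ cyc | v ∈ e} := by
      ext e
      simp only [mem_filter, mem_sdiff]
      tauto
    rw [this, cast_card_sdiff (filter_subset_filter _ hcycE), hdeg v hv]
    norm_num
  have hncK' : ∀ v ∉ K, {e ∈ G.internalEdges \ cyc | v ∈ e} = {e ∈ G.internalEdges | v ∈ e} := by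
    intro v hv
    ext e
    simp only [mem_filter, mem_sdiff]
    exact ⟨fun h => ⟨h.1.1, h.2⟩, fun h => ⟨⟨h.1, fun h' => hv (hmem e h' v h.2)⟩, h.2⟩⟩
  set N := G.leafSupports with hN
  set D : Finset V := univ.filter G.IsDeep with hD
  -- A leaf adjacent to `v` is off the cycle, so it belongs to the tree rooted at `v`.
  have hNdeg : ∀ v ∈ K ∩ N, 3 ≤ G.degree v := by
    intro v hv
    rw [mem_inter] at hv
    obtain ⟨h2, w, hw, hl⟩ := mem_leafSupports.1 hv.2
    refine ((mem_nontrivialRoots_iff hKv hce hsub hdeg v).1 ⟨?_, ?_⟩).2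
    · rw [← hKv]; exact hv.1
    · refine ⟨v, ConnectedComponent.connectedComponentMk_mem, w, ?_, hw.ne⟩
      rw [rootedTreeVerts, ConnectedComponent.mem_supp_iff, ConnectedComponent.eq]
      refine (Adj.reachable ?_).symm
      rw [deleteEdges_adj]
      refine ⟨hw, fun h => ?_⟩
      rw [← hce] at h
      have := hdeg2 w (hmem _ h w (by simp))
      omega
  have hKND : K = (K ∩ N) ∪ (K ∩ D) := by
    ext v
    simp only [mem_union, mem_inter, hD, mem_filter, mem_univ, true_and]
    constructor
    · intro hv
      by_cases h : v ∈ N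
      · exact Or.inl ⟨hv, h⟩
      · rcases isDeep_or_of_notMem_leafSupports h with h | h
        · exact Or.inr ⟨hv, h⟩
        · have := hdeg2 v hv
          omega
    · rintro (h | h) <;> exact h.1
  have hND : Disjoint N D := by
    rw [Finset.disjoint_left]
    intro v hv hv'
    exact (mem_filter.1 hv').2.notMem_leafSupports hv
  have hKcard : #K = #(K ∩ N) + #(K ∩ D) := by
    conv_lhs => rw [hKND]
    exact card_union_of_disjoint (hND.mono inter_subset_right inter_subset_right)
  -- Taking the constant weight `ofAdd 1` in `Multiplicative ℕ` turns the product formula into a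
  -- count.
  have hDcard : #D = p + s := by
    have := prod_deep (G := G) (M := Multiplicative ℕ) (fun _ => Multiplicative.ofAdd 1)
    rw [prod_const, prod_const, prod_const, hs, hp, ← pow_add] at this
    simpa using this
  have hDcard' : #D = #(D \ K) + #(K ∩ D) := by
    rw [inter_comm, card_sdiff_add_card_inter]
  -- A root of a nontrivial tree either has an adjacent leaf or is a sprout. Hence the three cases
  -- of the theorem are `#(K ∩ N) = 0`, `1` and `≥ 2`.
  have hrs : r = s + #(K ∩ N) := by
    have h1 : G.nontrivialRoots = ((G.sprouts ∪ (K ∩ N) : Finset V) : Set V) := by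
      ext v
      rw [mem_nontrivialRoots_iff hKv hce hsub hdeg, mem_coe, mem_union, mem_sprouts, hspr]
      constructor
      · rintro ⟨h1, h2⟩
        rw [hKND, mem_union] at h1
        rcases h1 with h1 | h1
        · exact Or.inr h1
        · rw [mem_inter] at h1
          exact Or.inl ⟨(mem_filter.1 h1.2).2, h1.1, h2⟩
      · rintro (h | h)
        · exact h.2
        · exact ⟨mem_of_mem_inter_left h, hNdeg v h⟩
    rw [← hr, h1, Set.ncard_coe_finset, card_union_of_disjoint, hs]
    rw [Finset.disjoint_left]
    intro v hv hv'
    exact (mem_sprouts.1 hv).1.notMem_leafSupports (mem_of_mem_inter_right hv')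
  have hmain := signed_count_unicyclic (E := G.internalEdges)
    (fun e he => G.not_isDiag_of_mem_edgeSet (mem_edgeFinset.1 (hEsub he))) hcycE hab
    (fun S hS => hacy S (hS.trans hEsub)) (hmem _ hab a (by simp)) (hmem _ hab b (by simp))
    hK hK' N
  have hprodT : ∀ T : Finset V, Disjoint T N →
      ∏ v ∈ T, (1 - (#{e ∈ G.internalEdges | v ∈ e} : ℚ)) =
        ∏ v ∈ T ∩ D, (1 - (G.degree v : ℚ)) := by
    intro T hT
    rw [← prod_subset (inter_subset_left : T ∩ D ⊆ T)]
    · refine prod_congr rfl fun v hv => ?_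
      rw [(mem_filter.1 (mem_of_mem_inter_right hv)).2.card_internalEdges]
    · intro v hv hv'
      rcases isDeep_or_of_notMem_leafSupports (Finset.disjoint_left.1 hT hv) with h | h
      · exact (hv' (mem_inter.2 ⟨hv, mem_filter.2 ⟨mem_univ _, h⟩⟩)).elim
      · rw [card_internalEdges_of_degree_lt h]
        simp
  have hfirst : ∏ v ∈ Nᶜ, (1 - (#{e ∈ G.internalEdges | v ∈ e} : ℚ)) =
      (-1) ^ (p + s) * ((∏ u ∈ G.nonSproutDeep, ((G.degree u : ℚ) - 1)) *
        ∏ v ∈ G.sprouts, ((G.degree v : ℚ) - 1)) := by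
    rw [hprodT _ disjoint_compl_left, inter_eq_right.2 (fun v hv => mem_compl.2
      (Finset.disjoint_right.1 hND hv)), prod_one_sub_eq, hDcard, hD, prod_deep]
  -- Non-sprout deep vertices on the cycle are missing on the left, but they have degree two and
  -- contribute the factor `1`.
  have hsecond : ∏ v ∈ Kᶜ \ N, (1 - (#{e ∈ G.internalEdges \ cyc | v ∈ e} : ℚ)) =
      (-1) ^ #(D \ K) * ∏ u ∈ G.nonSproutDeep, ((G.degree u : ℚ) - 1) := by
    have h1 : (Kᶜ \ N) ∩ D = D \ K := by
      ext v
      simp only [mem_inter, mem_sdiff, mem_compl]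
      exact ⟨fun h => ⟨h.2, h.1.1⟩, fun h => ⟨⟨h.2, Finset.disjoint_right.1 hND h.1⟩, h.1⟩⟩
    rw [prod_congr rfl fun v hv => by
      rw [hncK' v (mem_compl.1 (mem_sdiff.1 hv).1)], hprodT _ sdiff_disjoint, h1, prod_one_sub_eq]
    congr 1
    refine prod_subset ?_ ?_
    · intro v hv
      rw [mem_sdiff] at hv
      rw [mem_nonSproutDeep, hspr]
      exact ⟨(mem_filter.1 hv.1).2, fun h => hv.2 h.2.1⟩
    · intro v hv hv'
      rw [mem_nonSproutDeep, hspr] at hv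
      have hvK : v ∈ K := by
        by_contra h
        exact hv' (mem_sdiff.2 ⟨mem_filter.2 ⟨mem_univ _, hv.1⟩, h⟩)
      have h2 := hdeg2 v hvK
      have h3 : ¬ 3 ≤ G.degree v := fun h => hv.2 ⟨hv.1, hvK, h⟩
      have : G.degree v = 2 := by omega
      rw [this]
      norm_num
  -- The cycle has as many edges as vertices, and its vertices split into `K ∩ N` and `K ∩ D`.
  have hsign : (-1 : ℚ) ^ #cyc * (-1) ^ #(D \ K) = (-1) ^ (p + s) * (-1) ^ #(K ∩ N) := by
    rw [hcard, hKcard, ← hDcard, hDcard', ← pow_add, ← pow_add]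
    have : #(K ∩ N) + #(K ∩ D) + #(D \ K) = #(D \ K) + #(K ∩ D) + #(K ∩ N) := by omega
    rw [this]
  -- When `K` misses `N`, every cycle vertex is deep and contributes its degree minus two, which
  -- vanishes off the sprouts.
  have hsum : #(K ∩ N) = 0 → ∑ v ∈ K, (#{e ∈ G.internalEdges \ cyc | v ∈ e} : ℚ) =
      ∑ v ∈ G.sprouts, (G.degree v : ℚ) - 2 * s := by
    intro h
    have hKD : ∀ v ∈ K, G.IsDeep v := by
      intro v hv
      rw [hKND, card_eq_zero.1 h, empty_union, mem_inter] at hv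
      exact (mem_filter.1 hv.2).2
    have : ∑ v ∈ G.sprouts, (G.degree v : ℚ) - 2 * s =
        ∑ v ∈ G.sprouts, ((G.degree v : ℚ) - 2) := by
      rw [sum_sub_distrib, sum_const, hs, nsmul_eq_mul, mul_comm]
    rw [this, sum_congr rfl fun v hv => by rw [hncK v hv, (hKD v hv).card_internalEdges]]
    symm
    refine sum_subset ?_ ?_
    · intro v hv
      exact ((hspr v).1 (mem_sprouts.1 hv)).2.1
    · intro v hv hv'
      rw [mem_sprouts, hspr] at hv'
      have h2 := hdeg2 v hv
      have h3 : ¬ 3 ≤ G.degree v := fun h => hv' ⟨hKD v hv, hv, h⟩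
      have : G.degree v = 2 := by omega
      rw [this]
      norm_num
  have hassoc : ∀ x y z w : ℚ, x * (y * (z * w)) = x * z * (y * w) := fun x y z w => by ring
  rw [hmain, hfirst, hsecond, hassoc, hsign]
  have c1 : r = s ↔ #(K ∩ N) = 0 := by omega
  have c2 : r = s + 1 ↔ #(K ∩ N) = 1 := by omega
  simp only [c1, c2]
  split_ifs with h0 h1
  · rw [h0, hsum h0]
    ring
  · rw [h1]
    ring
  · ring

/-! ### Non-vanishing of the value, by a Weierstrass product inequality -/

theorem one_add_sum_le_prod {ι : Type*} (s : Finset ι) (a : ι → ℚ) (ha : ∀ i ∈ s, 0 ≤ a i) :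
    1 + ∑ i ∈ s, a i ≤ ∏ i ∈ s, (1 + a i) := by
  classical
  induction s using Finset.induction_on with
  | empty => simp
  | @insert i s hi ih =>
    have h1 := ih fun j hj => ha j (mem_insert_of_mem hj)
    have h2 := ha i (mem_insert_self _ _)
    have h3 : 0 ≤ ∑ j ∈ s, a j := sum_nonneg fun j hj => ha j (mem_insert_of_mem hj)
    rw [sum_insert hi, prod_insert hi]
    nlinarith [mul_nonneg h2 h3, mul_le_mul_of_nonneg_left h1 (by linarith : 0 ≤ 1 + a i)]

/-- With two factors, a product of two positive terms appears in the expansion; this is where `r ≥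
2` matters when `r = s`. -/
theorem one_add_sum_lt_prod {ι : Type*} (s : Finset ι) (a : ι → ℚ) (ha : ∀ i ∈ s, 0 < a i)
    (hs : 2 ≤ #s) : 1 + ∑ i ∈ s, a i < ∏ i ∈ s, (1 + a i) := by
  classical
  obtain ⟨i, hi⟩ : s.Nonempty := card_pos.1 (by omega)
  have hne : (s.erase i).Nonempty := card_pos.1 (by rw [card_erase_of_mem hi]; omega)
  have h1 := one_add_sum_le_prod (s.erase i) a fun j hj => (ha j (mem_of_mem_erase hj)).le
  have h3 : 0 < ∑ j ∈ s.erase i, a j := sum_pos (fun j hj => ha j (mem_of_mem_erase hj)) hne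
  rw [← add_sum_erase s a hi, ← mul_prod_erase s _ hi]
  have h2 := ha i hi
  nlinarith [mul_pos h2 h3, mul_le_mul_of_nonneg_left h1 (by linarith : 0 ≤ 1 + a i)]

/-- The value of the signed count does not vanish if there are two non-trivial rooted trees. -/
theorem signed_count_value_ne_zero {r s : ℕ} (p : ℕ) (hs : G.sprouts.card = s) (hr2 : 2 ≤ r) :
    (-1) ^ (p + s) *
      ((∏ u ∈ G.nonSproutDeep, ((G.degree u : ℚ) - 1)) *
        (if r = s then
          (∏ v ∈ G.sprouts, ((G.degree v : ℚ) - 1)) - (∑ v ∈ G.sprouts, (G.degree v : ℚ))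
            + 2 * (s : ℚ) - 1
        else if r = s + 1 then
          (∏ v ∈ G.sprouts, ((G.degree v : ℚ) - 1)) - 1
        else
          ∏ v ∈ G.sprouts, ((G.degree v : ℚ) - 1))) ≠ 0 := by
  have hpos : ∀ v ∈ G.sprouts, (0 : ℚ) < (G.degree v : ℚ) - 2 := by
    intro v hv
    have : (3 : ℚ) ≤ G.degree v := by exact_mod_cast (mem_sprouts.1 hv).2.2
    linarith
  have hprod : ∏ v ∈ G.sprouts, ((G.degree v : ℚ) - 1) =
      ∏ v ∈ G.sprouts, (1 + ((G.degree v : ℚ) - 2)) :=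
    prod_congr rfl fun v _ => by ring
  have hle := one_add_sum_le_prod G.sprouts _ fun v hv => (hpos v hv).le
  rw [← hprod] at hle
  refine mul_ne_zero (pow_ne_zero _ (by norm_num)) (mul_ne_zero ?_ ?_)
  · refine prod_ne_zero_iff.2 fun v hv => ?_
    have : (2 : ℚ) ≤ G.degree v := by exact_mod_cast (mem_nonSproutDeep.1 hv).1.1
    linarith
  split_ifs with h0 h1
  -- Here `a = b - 2`, so the inequality reads `∏ (b - 1) > 1 + ∑ b - 2 s`; it applies since `s = r
  -- ≥ 2`. In the next case `s = r - 1 ≥ 1` suffices.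
  · have h := one_add_sum_lt_prod G.sprouts _ hpos (by omega)
    rw [← hprod, sum_sub_distrib, sum_const, hs, nsmul_eq_mul] at h
    linarith
  · have h : 0 < ∑ v ∈ G.sprouts, ((G.degree v : ℚ) - 2) :=
      sum_pos hpos (card_pos.1 (by omega))
    linarith
  · have h : 0 ≤ ∑ v ∈ G.sprouts, ((G.degree v : ℚ) - 2) := sum_nonneg fun v hv => (hpos v hv).le
    linarith

end UnicyclicCount

end SimpleGraph

/-! ### Restriction of power series to finitely many variables -/

/-- Setting all variables outside `A` to zero. -/
noncomputable def restrictVars (A : Finset ℕ) : MvPowerSeries ℕ ℚ →ₐ[ℚ] MvPowerSeries ℕ ℚ :=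
  AlgHom.ofLinearMap
    { toFun := fun f d => if d.support ⊆ A then MvPowerSeries.coeff d f else 0
      map_add' := fun f g => by
        funext d
        change (if d.support ⊆ A then MvPowerSeries.coeff d (f + g) else 0) =
          (if d.support ⊆ A then MvPowerSeries.coeff d f else 0) +
            (if d.support ⊆ A then MvPowerSeries.coeff d g else 0)
        split_ifs <;> simp
      map_smul' := fun c f => by
        funext d
        change (if d.support ⊆ A then MvPowerSeries.coeff d (c • f) else 0) =
          c * (if d.support ⊆ A then MvPowerSeries.coeff d f else 0)
        split_ifs <;> simp }
    (by
      funext d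
      change (if d.support ⊆ A then _ else _) = MvPowerSeries.coeff d 1
      split_ifs with h
      · rfl
      · classical
        rw [MvPowerSeries.coeff_one, if_neg]
        rintro rfl
        simp at h)
    (fun f g => by
      classical
      ext d
      change (if d.support ⊆ A then _ else _) = _
      rw [MvPowerSeries.coeff_mul, MvPowerSeries.coeff_mul]
      have hsupp : ∀ p ∈ HasAntidiagonal.antidiagonal d, d.support = p.1.support ∪ p.2.support := by
        intro p hp
        rw [HasAntidiagonal.mem_antidiagonal] at hp
        ext i
        rw [← hp]
        simp
        tauto
      split_ifs with h
      · refine sum_congr rfl fun p hp => ?_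
        rw [hsupp p hp, union_subset_iff] at h
        change _ = (if p.1.support ⊆ A then _ else _) *
          (if p.2.support ⊆ A then _ else _)
        rw [if_pos h.1, if_pos h.2]
      · symm
        refine sum_eq_zero fun p hp => ?_
        rw [hsupp p hp, union_subset_iff, not_and_or] at h
        change (if p.1.support ⊆ A then _ else _) *
          (if p.2.support ⊆ A then _ else _) = _
        rcases h with h | h
        · rw [if_neg h, zero_mul]
        · rw [if_neg h, mul_zero])

theorem coeff_restrictVars (A : Finset ℕ) (f : MvPowerSeries ℕ ℚ) (d : ℕ →₀ ℕ) :
    MvPowerSeries.coeff d (restrictVars A f) =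
      if d.support ⊆ A then MvPowerSeries.coeff d f else 0 := rfl

/-- Each coefficient survives restriction to its own support. Identities thus reduce to finitely
many colors, where all sums are finite. -/
theorem eq_of_restrictVars {f g : MvPowerSeries ℕ ℚ}
    (h : ∀ A, restrictVars A f = restrictVars A g) : f = g := by
  ext d
  have := congrArg (MvPowerSeries.coeff d) (h d.support)
  simpa [coeff_restrictVars] using this

/-- The generating function of the proper colorings with finitely many colors, where a vertex of
color `i` has weight `x i`. -/
noncomputable def coloringSum {V R α : Type*} [Fintype V] [CommRing R] [Fintype α]
    (G : SimpleGraph V) (F : V → α → R) : R := by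
  classical
  exact ∑ κ : V → α, if ∀ u v, G.Adj u v → κ u ≠ κ v then ∏ v, F v (κ v) else 0

theorem coloringSum_eq {V R α : Type*} [Fintype V] [DecidableEq V] [CommRing R] [Fintype α]
    (G : SimpleGraph V) (F : V → α → R)
    [DecidablePred fun κ : V → α => ∀ u v, G.Adj u v → κ u ≠ κ v] :
    coloringSum G F =
      ∑ κ : V → α, if ∀ u v, G.Adj u v → κ u ≠ κ v then ∏ v, F v (κ v) else 0 := by
  unfold coloringSum
  congr!

theorem restrictVars_chromaticSymm {V : Type*} [Fintype V] (G : SimpleGraph V) (A : Finset ℕ) :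
    restrictVars A (chromaticSymm G) =
      coloringSum G (fun _ (i : A) => (MvPowerSeries.X (i : ℕ) : MvPowerSeries ℕ ℚ)) := by
  classical
  ext d
  have hmon : ∀ κ : V → A, ∏ v, (MvPowerSeries.X (κ v : ℕ) : MvPowerSeries ℕ ℚ) =
      MvPowerSeries.monomial (∑ v, Finsupp.single (κ v : ℕ) 1) 1 := by
    intro κ
    simp only [MvPowerSeries.X_def]
    rw [MvPowerSeries.prod_monomial, prod_const_one]
  rw [coeff_restrictVars, coloringSum_eq, map_sum]
  have hterm : ∀ κ : V → A, MvPowerSeries.coeff d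
      (if ∀ u v, G.Adj u v → κ u ≠ κ v then
        ∏ v, (MvPowerSeries.X (κ v : ℕ) : MvPowerSeries ℕ ℚ) else 0) =
      if (∀ u v, G.Adj u v → κ u ≠ κ v) ∧ ∑ v, Finsupp.single (κ v : ℕ) 1 = d then 1 else 0 := by
    intro κ
    rw [hmon]
    by_cases h : ∀ u v, G.Adj u v → κ u ≠ κ v
    · rw [if_pos h, MvPowerSeries.coeff_monomial]
      exact if_congr ⟨fun h' => ⟨h, h'.symm⟩, fun h' => h'.2.symm⟩ rfl rfl
    · rw [if_neg h, if_neg (fun h' => h h'.1), map_zero]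
  rw [sum_congr rfl fun κ _ => hterm κ, sum_boole]
  split_ifs with hd
  · change (Nat.card _ : ℚ) = _
    congr 1
    rw [← Fintype.card_subtype, ← Nat.card_eq_fintype_card]
    symm
    refine Nat.card_eq_of_bijective
      (fun κ => ⟨SimpleGraph.Coloring.mk (fun v => (κ.1 v : ℕ)) (fun {u v} h h' =>
        κ.2.1 u v h (Subtype.ext h')), κ.2.2⟩) ⟨?_, ?_⟩
    · intro κ κ' h
      ext v
      have := congrArg (fun c => c.1 v) h
      exact this
    · rintro ⟨c, hc⟩
      have hmem : ∀ v, c v ∈ A := by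
        intro v
        apply hd
        rw [← hc, Finsupp.mem_support_iff, Finsupp.finsetSum_apply]
        refine (Finset.sum_pos' (fun _ _ => Nat.zero_le _) ⟨v, mem_univ _, by simp⟩).ne'
      exact ⟨⟨fun v => ⟨c v, hmem v⟩, fun u v h h' => c.valid h (congrArg Subtype.val h'), hc⟩, rfl⟩
  · symm
    rw [Nat.cast_eq_zero, card_eq_zero, filter_eq_empty_iff]
    rintro κ - ⟨-, h⟩
    apply hd
    intro i hi
    rw [← h, Finsupp.mem_support_iff, Finsupp.finsetSum_apply] at hi
    obtain ⟨v, -, hv⟩ := exists_ne_zero_of_sum_ne_zero hi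
    rw [Finsupp.single_apply] at hv
    split_ifs at hv with h'
    · rw [← h']; exact (κ v).2
    · exact absurd rfl hv

/-! ### Expansions of coloring sums -/

section ColoringSum

variable {V R α : Type*} [Fintype V] [CommRing R] [Fintype α]

theorem ite_eq_ite_of_iff {β : Type*} {p q : Prop} {_ : Decidable p} {_ : Decidable q}
    (h : p ↔ q) (a b : β) : (if p then a else b) = if q then a else b := by
  by_cases hp : p
  · rw [if_pos hp, if_pos (h.1 hp)]
  · rw [if_neg hp, if_neg (fun hq => hp (h.2 hq))]

/-- Summing out the colors of vertices of degree one. -/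
theorem coloringSum_leaves (G : SimpleGraph V) (p : V → Prop) [DecidablePred p]
    [DecidableEq {v // p v}]
    (nb : {v // ¬ p v} → {v // p v}) (hnb : ∀ (l : {v // ¬ p v}) (w : V), G.Adj l w ↔ w = nb l)
    (x : α → R) :
    coloringSum G (fun _ => x) =
      coloringSum (G.comap (Subtype.val : {v // p v} → V))
        (fun v i => x i * (∑ j, x j - x i) ^ #{l | nb l = v}) := by
  classical
  rw [coloringSum_eq, coloringSum_eq, ← (Equiv.piEquivPiSubtypeProd p fun _ => α).symm.sum_comp,
    Fintype.sum_prod_type]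
  refine sum_congr rfl fun κ _ => ?_
  have happ : ∀ (κ' : {v // ¬ p v} → α),
      (∀ v : {v // p v}, (Equiv.piEquivPiSubtypeProd p fun _ => α).symm (κ, κ') v = κ v) ∧
      (∀ v : {v // ¬ p v}, (Equiv.piEquivPiSubtypeProd p fun _ => α).symm (κ, κ') v = κ' v) := by
    intro κ'
    constructor <;> intro v <;> simp [Equiv.piEquivPiSubtypeProd, v.2]
  have hterm : ∀ κ' : {v // ¬ p v} → α,
      (if ∀ u v, G.Adj u v → (Equiv.piEquivPiSubtypeProd p fun _ => α).symm (κ, κ') u ≠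
          (Equiv.piEquivPiSubtypeProd p fun _ => α).symm (κ, κ') v then
        ∏ v, x ((Equiv.piEquivPiSubtypeProd p fun _ => α).symm (κ, κ') v) else 0) =
      (if ∀ u v, (G.comap (Subtype.val : {v // p v} → V)).Adj u v → κ u ≠ κ v then
        ∏ v, x (κ v) else 0) *
        ∏ l, if κ' l ≠ κ (nb l) then x (κ' l) else 0 := by
    intro κ'
    rw [prod_ite_zero, ite_zero_mul_ite_zero,
      ← Fintype.prod_subtype_mul_prod_subtype p]
    simp only [happ κ']
    refine ite_eq_ite_of_iff ?_ _ _
    constructor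
    · intro h
      refine ⟨fun u v huv => ?_, fun l _ => ?_⟩
      · have := h u v huv
        rwa [(happ κ').1, (happ κ').1] at this
      · have := h l (nb l) ((hnb l _).2 rfl)
        rwa [(happ κ').1, (happ κ').2] at this
    · rintro ⟨h1, h2⟩ u v huv
      by_cases hu : p u <;> by_cases hv : p v
      · have := h1 ⟨u, hu⟩ ⟨v, hv⟩ huv
        rwa [← (happ κ').1, ← (happ κ').1] at this
      · obtain rfl := (hnb ⟨v, hv⟩ u).1 huv.symm
        have := h2 ⟨v, hv⟩ (mem_univ _)
        rw [← (happ κ').1, ← (happ κ').2] at this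
        exact this.symm
      · obtain rfl := (hnb ⟨u, hu⟩ v).1 huv
        have := h2 ⟨u, hu⟩ (mem_univ _)
        rw [← (happ κ').1, ← (happ κ').2] at this
        exact this
      · obtain rfl := (hnb ⟨u, hu⟩ v).1 huv
        exact (hv (nb ⟨u, hu⟩).2).elim
  rw [sum_congr rfl fun κ' _ => hterm κ', ← mul_sum]
  -- Each leaf independently takes any color other than that of its neighbor.
  have hsum : ∑ κ' : {v // ¬ p v} → α, ∏ l, (if κ' l ≠ κ (nb l) then x (κ' l) else 0) =
      ∏ v, (∑ j, x j - x (κ v)) ^ #{l | nb l = v} := by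
    have h1 := prod_univ_sum (fun _ : {v // ¬ p v} => (univ : Finset α))
      (fun l i => if i ≠ κ (nb l) then x i else 0)
    rw [Fintype.piFinset_univ] at h1
    rw [← h1, ← prod_fiberwise univ nb]
    refine prod_congr rfl fun v _ => ?_
    rw [← prod_const]
    refine prod_congr rfl fun l hl => ?_
    rw [(mem_filter.1 hl).2, ← sum_filter, filter_ne', ← add_sum_erase univ x (mem_univ (κ v)),
      add_sub_cancel_left]
  rw [hsum, ite_mul, zero_mul, prod_mul_distrib]

/-- A coloring that is constant along the edges of `S` amounts to one color for each block. -/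
theorem sum_const_on_blocks [DecidableEq V] (S : Finset (Sym2 V)) (F : V → α → R)
    [DecidablePred fun κ : V → α => ∀ e ∈ S, (Sym2.map κ e).IsDiag] :
    ∑ κ : V → α, (if ∀ e ∈ S, (Sym2.map κ e).IsDiag then ∏ v, F v (κ v) else 0) =
      ∏ C ∈ SimpleGraph.blocks S, ∑ i, ∏ v ∈ C, F v i := by
  classical
  have h1 := prod_univ_sum (fun _ : ↥(SimpleGraph.blocks S) => (univ : Finset α))
      (fun C i => ∏ v ∈ C.1, F v i)
  rw [Fintype.piFinset_univ] at h1
  rw [← prod_coe_sort, h1, ← sum_filter]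
  symm
  have hconst : ∀ κ : V → α, (∀ e ∈ S, (Sym2.map κ e).IsDiag) → ∀ u v,
      SimpleGraph.blockOf S u = SimpleGraph.blockOf S v → κ u = κ v := by
    intro κ hκ u v h
    rw [SimpleGraph.blockOf_eq_iff, SimpleGraph.reachable_iff_reflTransGen] at h
    induction h with
    | refl => rfl
    | tail _ hbc ih =>
      rw [ih]
      rw [SimpleGraph.fromEdgeSet_adj] at hbc
      simpa using hκ _ hbc.1
  refine sum_bij' (fun x _ v => x ⟨SimpleGraph.blockOf S v, SimpleGraph.blockOf_mem_blocks S v⟩)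
    (fun κ _ C => κ (SimpleGraph.nonempty_of_mem_blocks C.2).choose) ?_ ?_ ?_ ?_ ?_
  · intro x _
    rw [mem_filter]
    refine ⟨mem_univ _, fun e he => ?_⟩
    induction e using Sym2.ind with
    | _ u v =>
    rw [Sym2.map_mk, Sym2.mk_isDiag_iff]
    congr 2
    rw [SimpleGraph.blockOf_eq_iff]
    by_cases h : u = v
    · rw [h]
    · exact SimpleGraph.Adj.reachable (by rw [SimpleGraph.fromEdgeSet_adj]; exact ⟨he, h⟩)
  · intros
    exact mem_univ _
  · intro x _
    funext C
    have := (SimpleGraph.nonempty_of_mem_blocks C.2).choose_spec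
    have h2 := SimpleGraph.eq_blockOf C.2 this
    simp only
    congr 1
    exact Subtype.ext h2.symm
  · intro κ hκ
    funext v
    refine hconst κ (mem_filter.1 hκ).2 _ _ ?_
    have h := SimpleGraph.blockOf_mem_blocks S v
    exact (SimpleGraph.eq_blockOf h (SimpleGraph.nonempty_of_mem_blocks h).choose_spec).symm
  · intro x _
    refine Eq.trans ?_ (SimpleGraph.prod_blocks S (fun v =>
      F v (x ⟨SimpleGraph.blockOf S v, SimpleGraph.blockOf_mem_blocks S v⟩)))
    rw [← prod_coe_sort (SimpleGraph.blocks S)]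
    refine prod_congr rfl fun C _ => ?_
    refine prod_congr rfl fun v hv => ?_
    congr 2
    exact Subtype.ext (SimpleGraph.eq_blockOf C.2 hv)

/-- Inclusion–exclusion over the edges. -/
theorem coloringSum_eq_sum_powerset [DecidableEq V] (H : SimpleGraph V) [DecidableRel H.Adj]
    (F : V → α → R) :
    coloringSum H F = ∑ S ∈ H.edgeFinset.powerset,
      (-1) ^ #S * ∏ C ∈ SimpleGraph.blocks S, ∑ i, ∏ v ∈ C, F v i := by
  classical
  have h1 : ∀ κ : V → α, (if ∀ u v, H.Adj u v → κ u ≠ κ v then ∏ v, F v (κ v) else 0) =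
      ∑ S ∈ H.edgeFinset.powerset, (-1) ^ #S *
        if ∀ e ∈ S, (Sym2.map κ e).IsDiag then ∏ v, F v (κ v) else 0 := by
    intro κ
    have h := SimpleGraph.sum_powerset_mul_prod H.edgeFinset
      (fun e => if (Sym2.map κ e).IsDiag then (1 : R) else 0) (∏ v, F v (κ v))
    simp only [prod_ite_zero, prod_const_one, mul_ite, mul_one, mul_zero] at h ⊢
    rw [h]
    have h2 : ∏ e ∈ H.edgeFinset, (1 - if (Sym2.map κ e).IsDiag then (1 : R) else 0) =
        if ∀ u v, H.Adj u v → κ u ≠ κ v then 1 else 0 := by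
      have : ∀ e ∈ H.edgeFinset, (1 - if (Sym2.map κ e).IsDiag then (1 : R) else 0) =
          if ¬ (Sym2.map κ e).IsDiag then 1 else 0 := by
        intro e _
        split_ifs <;> simp_all
      rw [prod_congr rfl this, prod_ite_zero, prod_const_one]
      refine ite_eq_ite_of_iff ?_ _ _
      constructor
      · intro h u v huv
        simpa using h s(u, v) (by simpa using huv)
      · intro h e he
        induction e using Sym2.ind with
        | _ u v => simpa using h u v (by simpa using he)
    rw [h2, mul_ite, mul_one, mul_zero]
  rw [coloringSum_eq, sum_congr rfl fun κ _ => h1 κ, sum_comm]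
  refine sum_congr rfl fun S _ => ?_
  rw [← mul_sum, sum_const_on_blocks]

/-- With `P = ∑ x`, this is the binomial expansion of `x^(c-1) = (-(P - x) + P)^(c-1)`. The inner
sums on the right are star functions on `m + j + 1` vertices, and `P` is the star on one vertex. -/
theorem sum_pow_mul_pow (x : α → R) {c : ℕ} (hc : 0 < c) (m : ℕ) :
    ∑ i, x i ^ c * (∑ k, x k - x i) ^ m = ∑ j ∈ range c, ((-1) ^ j * ((c - 1).choose j : R)) *
      ((∑ i, x i * (∑ k, x k - x i) ^ (m + j)) * (∑ k, x k) ^ (c - 1 - j)) := by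
  obtain ⟨c, rfl⟩ := Nat.exists_eq_add_of_lt hc
  simp only [zero_add, Nat.add_sub_cancel]
  set P := ∑ k, x k
  have h : ∀ i, x i ^ (c + 1) * (P - x i) ^ m = ∑ j ∈ range (c + 1),
      ((-1) ^ j * (c.choose j : R)) * ((x i * (P - x i) ^ (m + j)) * P ^ (c - j)) := by
    intro i
    have h2 : x i = -(P - x i) + P := by ring
    have h3 := add_pow (-(P - x i)) P c
    rw [← h2] at h3
    rw [pow_succ, h3, sum_mul, sum_mul]
    refine sum_congr rfl fun j _ => ?_
    rw [neg_pow, pow_add]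
    ring
  rw [sum_congr rfl fun i _ => h i, sum_comm]
  refine sum_congr rfl fun j _ => ?_
  rw [← mul_sum, sum_mul]

end ColoringSum

theorem restrictVars_starSymm (A : Finset ℕ) (k : ℕ) :
    restrictVars A (starSymm (k + 1)) =
      ∑ i : A, (MvPowerSeries.X (i : ℕ) : MvPowerSeries ℕ ℚ) *
        (∑ j : A, MvPowerSeries.X (j : ℕ) - MvPowerSeries.X (i : ℕ)) ^ k := by
  classical
  -- Only the center is kept. It is singled out by its label rather than its degree, so that `k = 0`
  -- and `k = 1` are covered too.
  obtain ⟨p, hp⟩ : ∃ p : Fin (k + 1) → Prop, ∀ v, p v ↔ v = 0 := ⟨_, fun _ => Iff.rfl⟩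
  let u₀ : Unique {v // p v} :=
    ⟨⟨⟨0, (hp 0).2 rfl⟩⟩, fun v => Subtype.ext ((hp _).1 v.2)⟩
  rw [starSymm, restrictVars_chromaticSymm, coloringSum_leaves _ p (fun _ => default),
    coloringSum_eq]
  · rw [← (Equiv.funUnique {v // p v} A).symm.sum_comp]
    refine sum_congr rfl fun i _ => ?_
    rw [if_pos, Fintype.prod_unique]
    · have : Fintype.card {v // ¬ p v} = k := by
        have h1 : Fintype.card {v // p v} = 1 := Fintype.card_unique
        rw [Fintype.card_subtype_compl, h1]
        simp
      simp [this]
    · intro u v h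
      exact absurd (Subsingleton.elim u v) h.ne
  · rintro ⟨l, hl⟩ w
    rw [hp] at hl
    simp only [SimpleGraph.starGraph_adj]
    constructor
    · rintro ⟨_, h | h⟩
      · exact absurd h hl
      · exact h
    · rintro rfl
      exact ⟨hl, Or.inr rfl⟩

/-! ### Star expansions -/

section StarExpansion

variable {W : Type*}

/-- The parts contributed by a block `C` in the `j`-th term of its expansion. -/
def blockParts (l : W → ℕ) (C : Finset W) (j : ℕ) : Multiset ℕ :=
  (∑ v ∈ C, l v + j + 1) ::ₘ Multiset.replicate (#C - 1 - j) 1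

theorem sum_blockParts (l : W → ℕ) {C : Finset W} {j : ℕ} (hj : j < #C) :
    (blockParts l C j).sum = ∑ v ∈ C, (l v + 1) := by
  rw [blockParts, Multiset.sum_cons, Multiset.sum_replicate, sum_add_distrib, sum_const,
    smul_eq_mul, smul_eq_mul]
  omega

/-- Choice functions are total, with the dummy value `0` off `s`. Their type then does not depend on
`s`, which varies with the edge set. -/
theorem prod_sum_eq_sum_piFinset {ι R : Type*} [Fintype ι] [DecidableEq ι] [CommRing R]
    (s : Finset ι) (t : ι → Finset ℕ) (f : ι → ℕ → R) :
    ∏ a ∈ s, ∑ b ∈ t a, f a b =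
      ∑ φ ∈ Fintype.piFinset (fun a => if a ∈ s then t a else {0}), ∏ a ∈ s, f a (φ a) := by
  have h : ∀ g : ι → R, ∏ a ∈ s, g a = ∏ a, if a ∈ s then g a else 1 := by
    intro g
    rw [prod_ite_mem, univ_inter]
  simp only [h]
  rw [← prod_univ_sum (fun a => if a ∈ s then t a else {0})
    (fun a b => if a ∈ s then f a b else 1)]
  refine prod_congr rfl fun a _ => ?_
  split_ifs <;> simp

variable [Fintype W] [DecidableEq W]

/-- The index set of the terms of the star expansion. -/
noncomputable def expansionIndex (E : Finset (Sym2 W)) :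
    Finset ((_ : Finset (Sym2 W)) × (Finset W → ℕ)) :=
  E.powerset.sigma fun S =>
    Fintype.piFinset fun C => if C ∈ SimpleGraph.blocks S then range #C else {0}

/-- The coefficients of the terms of the star expansion. -/
noncomputable def expansionCoeff (i : (_ : Finset (Sym2 W)) × (Finset W → ℕ)) : ℚ :=
  (-1) ^ #i.1 * ∏ C ∈ SimpleGraph.blocks i.1, ((-1) ^ i.2 C * ((#C - 1).choose (i.2 C) : ℚ))

/-- The parts of the terms of the star expansion. -/
noncomputable def expansionParts (l : W → ℕ) (i : (_ : Finset (Sym2 W)) × (Finset W → ℕ)) :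
    Multiset ℕ :=
  ∑ C ∈ SimpleGraph.blocks i.1, blockParts l C (i.2 C)

theorem mem_expansionIndex {E : Finset (Sym2 W)} {i : (_ : Finset (Sym2 W)) × (Finset W → ℕ)}
    (hi : i ∈ expansionIndex E) : i.1 ⊆ E ∧ (∀ C ∈ SimpleGraph.blocks i.1, i.2 C < #C) ∧
      ∀ C ∉ SimpleGraph.blocks i.1, i.2 C = 0 := by
  rw [expansionIndex, mem_sigma, mem_powerset, Fintype.mem_piFinset] at hi
  refine ⟨hi.1, fun C hC => ?_, fun C hC => ?_⟩
  · simpa [hC] using hi.2 C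
  · simpa [hC] using hi.2 C

theorem sum_expansionParts (l : W → ℕ) {E : Finset (Sym2 W)}
    {i : (_ : Finset (Sym2 W)) × (Finset W → ℕ)} (hi : i ∈ expansionIndex E) :
    (expansionParts l i).sum = ∑ v, (l v + 1) := by
  rw [expansionParts, ← SimpleGraph.sum_blocks i.1]
  rw [← Multiset.coe_sumAddMonoidHom, map_sum]
  exact sum_congr rfl fun C hC => sum_blockParts l ((mem_expansionIndex hi).2.1 C hC)

theorem pos_of_mem_expansionParts (l : W → ℕ) (i : (_ : Finset (Sym2 W)) × (Finset W → ℕ))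
    {k : ℕ} (hk : k ∈ expansionParts l i) : 0 < k := by
  rw [expansionParts, Multiset.mem_sum] at hk
  obtain ⟨C, -, hC⟩ := hk
  rw [blockParts, Multiset.mem_cons, Multiset.mem_replicate] at hC
  omega

/-- The star expansion of a graph whose vertices outside `p` are leaves. -/
theorem chromaticSymm_eq_sum {V : Type*} [Fintype V] (G : SimpleGraph V) (p : V → Prop)
    [DecidablePred p] [DecidableEq {v // p v}]
    [DecidableRel (G.comap (Subtype.val : {v // p v} → V)).Adj]
    (nb : {v // ¬ p v} → {v // p v}) (hnb : ∀ (l : {v // ¬ p v}) (w : V), G.Adj l w ↔ w = nb l) :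
    chromaticSymm G =
      ∑ i ∈ expansionIndex (G.comap (Subtype.val : {v // p v} → V)).edgeFinset,
        expansionCoeff i • ((expansionParts (fun v => #{l | nb l = v}) i).map starSymm).prod := by
  set l : {v // p v} → ℕ := fun v => #{l | nb l = v} with hl
  refine eq_of_restrictVars fun A => ?_
  rw [restrictVars_chromaticSymm, coloringSum_leaves G p nb hnb, coloringSum_eq_sum_powerset,
    map_sum, expansionIndex, sum_sigma]
  refine sum_congr rfl fun S _ => ?_
  have hblock : ∀ C ∈ SimpleGraph.blocks S,
      ∑ i : A, ∏ v ∈ C, ((MvPowerSeries.X (i : ℕ) : MvPowerSeries ℕ ℚ) *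
        (∑ j : A, MvPowerSeries.X (j : ℕ) - MvPowerSeries.X (i : ℕ)) ^ l v) =
      ∑ j ∈ range #C, restrictVars A (((-1) ^ j * ((#C - 1).choose j : ℚ)) •
        ((blockParts l C j).map starSymm).prod) := by
    intro C hC
    simp only [prod_mul_distrib, prod_const, prod_pow_eq_pow_sum]
    rw [sum_pow_mul_pow _ (card_pos.2 (SimpleGraph.nonempty_of_mem_blocks hC))]
    refine sum_congr rfl fun j _ => ?_
    have h1 := restrictVars_starSymm A 0
    simp only [pow_zero, mul_one, zero_add] at h1
    rw [blockParts, Multiset.map_cons, Multiset.prod_cons, Multiset.map_replicate,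
      Multiset.prod_replicate, map_smul, map_mul, map_pow, restrictVars_starSymm, h1,
      Algebra.smul_def]
    simp
  rw [prod_congr rfl hblock, prod_sum_eq_sum_piFinset, mul_sum]
  refine sum_congr rfl fun φ _ => ?_
  rw [expansionCoeff, expansionParts, map_smul, mul_smul, ← Multiset.coe_mapAddMonoidHom, map_sum,
    Multiset.prod_sum, ← map_prod, prod_smul, map_smul, Algebra.smul_def ((-1 : ℚ) ^ _), map_pow,
    map_neg, map_one]

/-- Collecting the terms with the same parts. -/
theorem sum_smul_eq_sum_partition {ι : Type*} {n : ℕ} (T : Finset ι) (a : ι → ℚ)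
    (M : ι → Multiset ℕ) (hpos : ∀ i ∈ T, ∀ k ∈ M i, 0 < k) (hsum : ∀ i ∈ T, (M i).sum = n) :
    ∑ i ∈ T, a i • ((M i).map starSymm).prod =
      ∑ lam : n.Partition, (∑ i ∈ T with M i = lam.parts, a i) • starSymmPart lam := by
  simp only [sum_smul, sum_filter]
  rw [sum_comm]
  refine sum_congr rfl fun i hi => ?_
  rw [sum_eq_single (⟨M i, fun {k} hk => hpos i hi k hk, hsum i hi⟩ : n.Partition)]
  · rw [if_pos rfl]
    rfl
  · intro lam _ hlam
    rw [if_neg, zero_smul]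
    intro h
    exact hlam (Nat.Partition.ext h.symm)
  · simp

/-! ### Comparing partitions -/

/-- A weight that is additive and reflects the lexicographic order of partitions. -/
def lexWeight (B : ℕ) (M : Multiset ℕ) : ℕ := (M.map (B ^ ·)).sum

theorem lexWeight_sum {ι : Type*} (B : ℕ) (T : Finset ι) (M : ι → Multiset ℕ) :
    lexWeight B (∑ i ∈ T, M i) = ∑ i ∈ T, lexWeight B (M i) := by
  simp only [lexWeight]
  rw [← Multiset.coe_mapAddMonoidHom, map_sum, ← Multiset.coe_sumAddMonoidHom, map_sum]

/-- At the first difference `a < b`, fewer than `B` remaining parts of size at most `a` weigh less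
than `B^(a+1) ≤ B^b`. -/
theorem lexWeight_lt_of_lt {B : ℕ} : ∀ {l₁ l₂ : List ℕ}, l₁.Pairwise (· ≥ ·) →
    l₁.length < B → l₁ < l₂ → lexWeight B l₁ < lexWeight B l₂
  | [], [], _, _, h => absurd h (lt_irrefl _)
  | [], b :: l₂, _, hB, _ => by
    have : 0 < B := by simpa using hB
    simp [lexWeight, this]
  | a :: l₁, [], _, _, h => absurd h (by simp)
  | a :: l₁, b :: l₂, hs, hB, h => by
    rw [List.cons_lt_cons_iff] at h
    rw [List.pairwise_cons] at hs
    have hB0 : 0 < B := by omega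
    rcases h with h | ⟨rfl, h⟩
    · have h1 : lexWeight B ((a :: l₁ : List ℕ) : Multiset ℕ) ≤ (a :: l₁).length * B ^ a := by
        have := Multiset.sum_le_card_nsmul (((a :: l₁ : List ℕ) : Multiset ℕ).map (B ^ ·)) (B ^ a) (by
          intro x hx
          rw [Multiset.mem_map] at hx
          obtain ⟨k, hk, rfl⟩ := hx
          refine Nat.pow_le_pow_right hB0 ?_
          rw [Multiset.mem_coe, List.mem_cons] at hk
          rcases hk with rfl | hk
          · exact le_rfl
          · exact hs.1 k hk)
        simpa [lexWeight] using this
      have h2 : (a :: l₁).length * B ^ a < B * B ^ a := Nat.mul_lt_mul_of_pos_right hB (by positivity)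
      have h3 : B * B ^ a ≤ B ^ b := by
        rw [← pow_succ']
        exact Nat.pow_le_pow_right hB0 h
      have h4 : B ^ b ≤ lexWeight B ((b :: l₂ : List ℕ) : Multiset ℕ) := by
        simp [lexWeight]
      omega
    · have := lexWeight_lt_of_lt (B := B) hs.2 (by rw [List.length_cons] at hB; omega) h
      simp only [lexWeight, Multiset.map_coe, Multiset.sum_coe, List.map_cons, List.sum_cons] at *
      omega

theorem partsList_le_of_lexWeight_le {n B : ℕ} {lam mu : n.Partition}
    (hB : Multiset.card mu.parts < B) (h : lexWeight B lam.parts ≤ lexWeight B mu.parts) :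
    partsList lam ≤ partsList mu := by
  rw [← not_lt]
  intro h'
  have h1 := lexWeight_lt_of_lt (B := B) (Multiset.pairwise_sort mu.parts (· ≥ ·))
    (by rwa [Multiset.length_sort]) h'
  simp only [partsList, Multiset.sort_eq] at h1
  omega

/-- The parts of the leading term. -/
def leadParts (l : W → ℕ) : Multiset ℕ := ∑ v, {l v + 1}

/-- At most one vertex of the block has leaves. It gives the large part, and the other vertices give
the parts `1`. -/
theorem blockParts_zero_eq (l : W → ℕ) {C N : Finset W} (hN : ∀ v, v ∈ N ↔ 0 < l v)
    (hC : C.Nonempty) (h : #(C ∩ N) ≤ 1) : blockParts l C 0 = ∑ v ∈ C, {l v + 1} := by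
  obtain ⟨u, hu, huN⟩ : ∃ u ∈ C, ∀ v ∈ C, v ≠ u → l v = 0 := by
    rcases (C ∩ N).eq_empty_or_nonempty with h0 | ⟨u, hu⟩
    · obtain ⟨u, hu⟩ := hC
      refine ⟨u, hu, fun v hv _ => ?_⟩
      by_contra hl
      have : v ∈ C ∩ N := mem_inter.2 ⟨hv, (hN v).2 (Nat.pos_of_ne_zero hl)⟩
      rw [h0] at this
      simp at this
    · refine ⟨u, mem_of_mem_inter_left hu, fun v hv hne => ?_⟩
      by_contra hl
      have : v ∈ C ∩ N := mem_inter.2 ⟨hv, (hN v).2 (Nat.pos_of_ne_zero hl)⟩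
      exact hne (card_le_one.1 h _ this _ hu)
  rw [blockParts, sum_eq_single_of_mem u hu huN, ← add_sum_erase _ _ hu, Multiset.singleton_add,
    sum_congr rfl fun v hv => by
      rw [huN v (mem_of_mem_erase hv) (ne_of_mem_erase hv)], sum_const, card_erase_of_mem hu,
    Multiset.nsmul_singleton]
  simp

/-- The first part of the block term exceeds every `l v + 1`, because either `j > 0` or another
vertex of the block adds leaves. A single power of `B` then outweighs all `#C` smaller ones. -/
theorem lexWeight_lt_blockParts (l : W → ℕ) {C N : Finset W} (hN : ∀ v, v ∈ N ↔ 0 < l v)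
    {j B : ℕ} (h : ¬ (j = 0 ∧ #(C ∩ N) ≤ 1)) (hB : #C < B) :
    lexWeight B (∑ v ∈ C, {l v + 1}) < lexWeight B (blockParts l C j) := by
  have hB0 : 0 < B := by omega
  have hle : ∀ v ∈ C, l v + 1 ≤ ∑ w ∈ C, l w + j := by
    intro v hv
    rw [← add_sum_erase C l hv]
    by_cases hj : j = 0
    · have h1 : 1 < #(C ∩ N) := by
        by_contra h'
        exact h ⟨hj, by omega⟩
      obtain ⟨w, hw, hwv⟩ := exists_mem_ne h1 v
      rw [mem_inter, hN] at hw
      have := single_le_sum_of_canonicallyOrdered (f := l) (mem_erase.2 ⟨hwv, hw.1⟩)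
      omega
    · omega
  calc lexWeight B (∑ v ∈ C, {l v + 1}) = ∑ v ∈ C, B ^ (l v + 1) := by
        rw [lexWeight_sum]
        simp [lexWeight]
    _ ≤ #C * B ^ (∑ w ∈ C, l w + j) := by
        rw [← smul_eq_mul]
        exact sum_le_card_nsmul _ _ _ fun v hv => Nat.pow_le_pow_right hB0 (hle v hv)
    _ < B * B ^ (∑ w ∈ C, l w + j) := Nat.mul_lt_mul_of_pos_right hB (by positivity)
    _ ≤ lexWeight B (blockParts l C j) := by
        rw [← pow_succ', blockParts, lexWeight, Multiset.map_cons, Multiset.sum_cons]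
        exact Nat.le_add_right _ _

theorem lexWeight_leadParts_le (l : W → ℕ) {N : Finset W} (hN : ∀ v, v ∈ N ↔ 0 < l v) {B : ℕ}
    (hB : Fintype.card W < B) (i : (_ : Finset (Sym2 W)) × (Finset W → ℕ)) :
    lexWeight B (leadParts l) ≤ lexWeight B (expansionParts l i) ∧
      (lexWeight B (leadParts l) = lexWeight B (expansionParts l i) →
        ∀ C ∈ SimpleGraph.blocks i.1, i.2 C = 0 ∧ #(C ∩ N) ≤ 1) := by
  have hle : ∀ C ∈ SimpleGraph.blocks i.1,
      lexWeight B (∑ v ∈ C, {l v + 1}) ≤ lexWeight B (blockParts l C (i.2 C)) := by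
    intro C hC
    by_cases h : i.2 C = 0 ∧ #(C ∩ N) ≤ 1
    · rw [h.1, blockParts_zero_eq l hN (SimpleGraph.nonempty_of_mem_blocks hC) h.2]
    · exact (lexWeight_lt_blockParts l hN h ((card_le_univ C).trans_lt hB)).le
  have hsum : lexWeight B (leadParts l) =
      ∑ C ∈ SimpleGraph.blocks i.1, lexWeight B (∑ v ∈ C, {l v + 1}) := by
    rw [leadParts, ← SimpleGraph.sum_blocks i.1, lexWeight_sum]
  rw [hsum, expansionParts, lexWeight_sum]
  refine ⟨sum_le_sum hle, fun h C hC => ?_⟩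
  by_contra hC'
  exact (sum_lt_sum hle ⟨C, hC, lexWeight_lt_blockParts l hN hC'
    ((card_le_univ C).trans_lt hB)⟩).ne h

/-- Equality of weights forces `j = 0` in every block, so each `S` contributes at most one term; its
binomial coefficients are all `1`. -/
theorem sum_expansionCoeff_leadParts (l : W → ℕ) {N : Finset W} (hN : ∀ v, v ∈ N ↔ 0 < l v)
    (E : Finset (Sym2 W)) :
    ∑ i ∈ expansionIndex E with expansionParts l i = leadParts l, expansionCoeff i =
      ∑ S ∈ E.powerset, (-1) ^ #S *
        (if ∀ C ∈ SimpleGraph.blocks S, #(C ∩ N) ≤ 1 then 1 else 0) := by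
  have hB := Nat.lt_succ_self (Fintype.card W)
  rw [sum_filter, expansionIndex, sum_sigma]
  refine sum_congr rfl fun S _ => ?_
  have hiff : ∀ φ : Finset W → ℕ, expansionParts l ⟨S, φ⟩ = leadParts l →
      ∀ C ∈ SimpleGraph.blocks S, φ C = 0 ∧ #(C ∩ N) ≤ 1 := fun φ h =>
    (lexWeight_leadParts_le l hN hB ⟨S, φ⟩).2 (by rw [h])
  rw [sum_eq_single (0 : Finset W → ℕ)]
  · split_ifs with h1 h2 h2
    · simp [expansionCoeff]
    · exact absurd (fun C hC => (hiff 0 h1 C hC).2) h2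
    · refine absurd ?_ h1
      rw [expansionParts, leadParts, ← SimpleGraph.sum_blocks S]
      exact sum_congr rfl fun C hC =>
        blockParts_zero_eq l hN (SimpleGraph.nonempty_of_mem_blocks hC) (h2 C hC)
    · simp
  · intro φ hφ hne
    rw [if_neg]
    intro h
    apply hne
    funext C
    by_cases hC : C ∈ SimpleGraph.blocks S
    · exact (hiff φ h C hC).1
    · have := Fintype.mem_piFinset.1 hφ C
      simpa [hC] using this
  · intro h
    refine absurd ?_ h
    rw [Fintype.mem_piFinset]
    intro C
    split_ifs with hC
    · simpa using SimpleGraph.nonempty_of_mem_blocks hC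
    · simp

end StarExpansion

/-! ### Linear independence of the star basis -/

section LinearIndependence

open Classical in
/-- The power sum symmetric function. -/
noncomputable def powerSumSeries (k : ℕ) : MvPowerSeries ℕ ℚ :=
  fun d => if ∃ i, d = Finsupp.single i k then 1 else 0

theorem restrictVars_powerSumSeries (A : Finset ℕ) {k : ℕ} (hk : 0 < k) :
    restrictVars A (powerSumSeries k) =
      ∑ i : A, (MvPowerSeries.X (i : ℕ) : MvPowerSeries ℕ ℚ) ^ k := by
  classical
  ext d
  simp only [coeff_restrictVars, map_sum, MvPowerSeries.X_pow_eq, MvPowerSeries.coeff_monomial]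
  have hinj : ∀ i j : ℕ, Finsupp.single i k = Finsupp.single j k → i = j := fun i j h =>
    (Finsupp.single_left_inj hk.ne').1 h
  change (if _ then (if ∃ i, d = Finsupp.single i k then (1 : ℚ) else 0) else 0) = _
  by_cases h : ∃ i : A, d = Finsupp.single (i : ℕ) k
  · obtain ⟨i, rfl⟩ := h
    rw [if_pos, if_pos ⟨_, rfl⟩, sum_eq_single i, if_pos rfl]
    · intro j _ hj
      exact if_neg fun h => hj (Subtype.ext (hinj _ _ h).symm)
    · simp
    · refine Finsupp.support_single_subset.trans ?_
      simp
  · rw [sum_eq_zero fun i _ => if_neg fun h' => h ⟨i, h'⟩]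
    split_ifs with h1 h2
    · obtain ⟨i, rfl⟩ := h2
      refine absurd ⟨⟨i, h1 ?_⟩, rfl⟩ h
      simp [hk.ne']
    · rfl
    · rfl

/-- The span of the products of star functions of total degree `n`. -/
noncomputable def starSpan (n : ℕ) : Submodule ℚ (MvPowerSeries ℕ ℚ) :=
  Submodule.span ℚ (Set.range (starSymmPart : n.Partition → _))

theorem prod_starSymm_mem_starSpan {M : Multiset ℕ} (hM : ∀ k ∈ M, 0 < k) :
    (M.map starSymm).prod ∈ starSpan M.sum :=
  Submodule.subset_span ⟨⟨M, fun {k} hk => hM k hk, rfl⟩, rfl⟩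

theorem starSpan_mul_le (m n : ℕ) : starSpan m * starSpan n ≤ starSpan (m + n) := by
  rw [starSpan, starSpan, Submodule.span_mul_span, Submodule.span_le]
  rintro _ ⟨_, ⟨lam, rfl⟩, _, ⟨mu, rfl⟩, rfl⟩
  have h := prod_starSymm_mem_starSpan (M := lam.parts + mu.parts) (fun k hk => by
    rcases Multiset.mem_add.1 hk with h | h
    · exact lam.parts_pos h
    · exact mu.parts_pos h)
  rw [Multiset.map_add, Multiset.prod_add, Multiset.sum_add, lam.parts_sum, mu.parts_sum] at h
  exact h

/-- This is the expansion `sum_pow_mul_pow` with `m = 0`. -/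
theorem powerSumSeries_mem_starSpan {k : ℕ} (hk : 0 < k) : powerSumSeries k ∈ starSpan k := by
  have h : powerSumSeries k = ∑ j ∈ range k, ((-1 : ℚ) ^ j * ((k - 1).choose j : ℚ)) •
      (((j + 1) ::ₘ Multiset.replicate (k - 1 - j) 1).map starSymm).prod := by
    refine eq_of_restrictVars fun A => ?_
    have h1 := sum_pow_mul_pow (fun i : A => (MvPowerSeries.X (i : ℕ) : MvPowerSeries ℕ ℚ)) hk 0
    simp only [pow_zero, mul_one, zero_add] at h1
    rw [restrictVars_powerSumSeries A hk, h1, map_sum]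
    refine sum_congr rfl fun j _ => ?_
    have h2 := restrictVars_starSymm A 0
    simp only [pow_zero, mul_one, zero_add] at h2
    rw [Multiset.map_cons, Multiset.prod_cons, Multiset.map_replicate, Multiset.prod_replicate,
      map_smul, map_mul, map_pow, restrictVars_starSymm, h2, Algebra.smul_def]
    simp
  rw [h]
  refine Submodule.sum_mem _ fun j hj => Submodule.smul_mem _ _ ?_
  have := prod_starSymm_mem_starSpan (M := (j + 1) ::ₘ Multiset.replicate (k - 1 - j) 1) (by
    intro i hi
    rw [Multiset.mem_cons, Multiset.mem_replicate] at hi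
    omega)
  have hs : ((j + 1) ::ₘ Multiset.replicate (k - 1 - j) 1).sum = k := by
    rw [mem_range] at hj
    rw [Multiset.sum_cons, Multiset.sum_replicate, smul_eq_mul]
    omega
  rwa [hs] at this

theorem prod_powerSumSeries_mem_starSpan (M : Multiset ℕ) (hM : ∀ k ∈ M, 0 < k) :
    (M.map powerSumSeries).prod ∈ starSpan M.sum := by
  induction M using Multiset.induction_on with
  | empty =>
    have := prod_starSymm_mem_starSpan (M := 0) (by simp)
    simpa using this
  | cons a M ih =>
    rw [Multiset.map_cons, Multiset.prod_cons, Multiset.sum_cons]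
    exact starSpan_mul_le _ _ (Submodule.mul_mem_mul
      (powerSumSeries_mem_starSpan (hM a (Multiset.mem_cons_self _ _)))
      (ih fun k hk => hM k (Multiset.mem_cons_of_mem hk)))

theorem coeff_prod_powerSumSeries {ι : Type*} [Fintype ι] [DecidableEq ι] (L : ι → ℕ)
    (hL : ∀ i, 0 < L i) (d : ℕ →₀ ℕ) :
    MvPowerSeries.coeff d (∏ i, powerSumSeries (L i)) =
      #{f : ι → d.support | ∑ i, Finsupp.single (f i : ℕ) (L i) = d} := by
  have h : MvPowerSeries.coeff d (∏ i, powerSumSeries (L i)) =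
      MvPowerSeries.coeff d (restrictVars d.support (∏ i, powerSumSeries (L i))) := by
    rw [coeff_restrictVars, if_pos subset_rfl]
  rw [h, map_prod, prod_congr rfl fun i _ => restrictVars_powerSumSeries _ (hL i), prod_univ_sum,
    Fintype.piFinset_univ, map_sum]
  simp only [MvPowerSeries.X_pow_eq, MvPowerSeries.prod_monomial, prod_const_one,
    MvPowerSeries.coeff_monomial]
  rw [sum_boole]
  simp only [eq_comm]

/-- Every variable `e k` must be hit by some `f i`. With no more indices `i` than `k`, each is hit
exactly once, so the exponents agree. -/
theorem map_eq_map_of_sum_single_eq {ι κ : Type*} [Fintype ι] [Fintype κ] {L : ι → ℕ} {K : κ → ℕ}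
    (hK : ∀ k, 0 < K k) {f : ι → ℕ} {e : κ → ℕ} (he : Function.Injective e)
    (h : ∑ i, Finsupp.single (f i) (L i) = ∑ k, Finsupp.single (e k) (K k))
    (hcard : Fintype.card ι ≤ Fintype.card κ) :
    (univ : Finset ι).val.map L = (univ : Finset κ).val.map K := by
  classical
  have hR : ∀ k, (∑ k, Finsupp.single (e k) (K k)) (e k) = K k := by
    intro k
    rw [Finsupp.finsetSum_apply, sum_eq_single k]
    · simp
    · intro k' _ hne
      exact Finsupp.single_eq_of_ne (fun h => hne (he h.symm))
    · simp
  have hex : ∀ k, ∃ i, f i = e k := by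
    intro k
    have h1 := hR k
    rw [← h, Finsupp.finsetSum_apply] at h1
    by_contra hno
    push Not at hno
    rw [sum_eq_zero fun i _ => Finsupp.single_eq_of_ne (hno i).symm] at h1
    exact (hK k).ne h1
  choose g hg using hex
  have hginj : Function.Injective g := fun a b hab => he (by rw [← hg a, ← hg b, hab])
  have hbij : Function.Bijective g :=
    (Fintype.bijective_iff_injective_and_card g).2
      ⟨hginj, le_antisymm (Fintype.card_le_of_injective g hginj) hcard⟩
  have hLK : ∀ k, L (g k) = K k := by
    intro k
    rw [← hR k, ← h, Finsupp.finsetSum_apply, sum_eq_single (g k)]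
    · rw [hg, Finsupp.single_eq_same]
    · intro i _ hi
      obtain ⟨k', rfl⟩ := hbij.2 i
      refine Finsupp.single_eq_of_ne fun h' => hi ?_
      rw [hg] at h'
      rw [he h']
    · simp
  have hmap : (univ : Finset ι).val = (univ : Finset κ).val.map g := by
    rw [← Finset.map_univ_equiv (Equiv.ofBijective g hbij)]
    rfl
  rw [hmap, Multiset.map_map]
  exact Multiset.map_congr rfl fun k _ => hLK k

theorem linearIndependent_powerSum (n : ℕ) :
    LinearIndependent ℚ (fun lam : n.Partition => (lam.parts.map powerSumSeries).prod) := by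
  classical
  rw [Fintype.linearIndependent_iff]
  intro c hc
  by_contra! hne
  obtain ⟨nu, hnu⟩ := hne
  -- Take `mu` with the most parts and the monomial `d` giving each part its own variable. No other
  -- power sum product in the relation contains this monomial.
  obtain ⟨mu, hmu, hmax⟩ := exists_max_image (univ.filter fun lam : n.Partition => c lam ≠ 0)
    (fun lam => Multiset.card lam.parts) ⟨nu, by simp [hnu]⟩
  rw [mem_filter] at hmu
  have hprod : ∀ lam : n.Partition, (lam.parts.map powerSumSeries).prod =
      ∏ i : lam.parts.ToType, powerSumSeries (i : ℕ) := by
    intro lam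
    conv_lhs => rw [← Multiset.map_univ_coe lam.parts]
    rw [Multiset.map_map]
    rfl
  have hpos : ∀ (lam : n.Partition) (i : lam.parts.ToType), 0 < (i : ℕ) := fun lam i =>
    lam.parts_pos (Multiset.coe_mem)
  let e : mu.parts.ToType → ℕ := fun i => (Fintype.equivFin mu.parts.ToType i : ℕ)
  have he : Function.Injective e := fun a b h =>
    (Fintype.equivFin mu.parts.ToType).injective (Fin.ext h)
  set d : ℕ →₀ ℕ := ∑ i : mu.parts.ToType, Finsupp.single (e i) (i : ℕ) with hd
  have hcoeff : ∀ lam, c lam ≠ 0 → lam ≠ mu →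
      MvPowerSeries.coeff d (lam.parts.map powerSumSeries).prod = 0 := by
    intro lam hlam hlm
    rw [hprod, coeff_prod_powerSumSeries _ (hpos lam), Nat.cast_eq_zero, card_eq_zero,
      filter_eq_empty_iff]
    intro f _ hf
    have hle := hmax lam (by simp [hlam])
    have := map_eq_map_of_sum_single_eq (hpos mu) he hf (by simpa using hle)
    exact hlm (Nat.Partition.ext ((Multiset.map_univ_coe lam.parts).symm.trans
      (this.trans (Multiset.map_univ_coe mu.parts))))
  have h0 := congrArg (MvPowerSeries.coeff d) hc
  rw [map_sum, map_zero, sum_eq_single mu] at h0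
  · rw [map_smul, smul_eq_mul, mul_eq_zero] at h0
    rcases h0 with h0 | h0
    · exact hmu.2 h0
    · rw [hprod, coeff_prod_powerSumSeries _ (hpos mu), Nat.cast_eq_zero, card_eq_zero,
        filter_eq_empty_iff] at h0
      refine h0 (x := fun i => ⟨e i, ?_⟩) (mem_univ _) rfl
      rw [hd, Finsupp.mem_support_iff, Finsupp.finsetSum_apply]
      have : 0 < (Finsupp.single (e i) (i : ℕ)) (e i) := by simpa using hpos mu i
      exact (sum_pos' (fun _ _ => Nat.zero_le _) ⟨i, mem_univ _, this⟩).ne'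
  · intro lam _ hlam
    rw [map_smul, smul_eq_mul]
    by_cases h : c lam = 0
    · rw [h, zero_mul]
    · rw [hcoeff lam h hlam, mul_zero]
  · simp

/-- A dimension count: the star products span a space containing the independent power sum products,
which are equally numerous. -/
theorem linearIndependent_starSymmPart (n : ℕ) :
    LinearIndependent ℚ (starSymmPart : n.Partition → MvPowerSeries ℕ ℚ) := by
  rw [linearIndependent_iff_card_le_finrank_span,
    ← finrank_span_eq_card (linearIndependent_powerSum n)]
  have : Module.Finite ℚ (Submodule.span ℚ (Set.range (starSymmPart : n.Partition → _))) :=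
    FiniteDimensional.span_of_finite ℚ (Set.finite_range _)
  refine Submodule.finrank_mono (Submodule.span_le.2 ?_)
  rintro _ ⟨lam, rfl⟩
  have := prod_powerSumSeries_mem_starSpan lam.parts fun k hk => lam.parts_pos hk
  rwa [lam.parts_sum] at this

theorem IsStarExpansion.unique {V : Type*} [Fintype V] {G : SimpleGraph V}
    {c c' : (Fintype.card V).Partition → ℚ} (h : IsStarExpansion G c) (h' : IsStarExpansion G c') :
    c' = c := by
  have h0 := Fintype.linearIndependent_iff.1 (linearIndependent_starSymmPart (Fintype.card V))
    (c' - c) (by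
      simp only [Pi.sub_apply, sub_smul, sum_sub_distrib]
      rw [← h, ← h', sub_self])
  funext lam
  exact sub_eq_zero.1 (h0 lam)

end LinearIndependence

/-! ### Internal vertices of a unicyclic graph -/

section InternalVertices

variable {V : Type*} [Fintype V] {G : SimpleGraph V} [DecidableRel G.Adj]

theorem SimpleGraph.blocks_inter_card_le_one_iff {W : Type*} [Fintype W] [DecidableEq W]
    (S : Finset (Sym2 W)) (N : Finset W) :
    (∀ C ∈ SimpleGraph.blocks S, #(C ∩ N) ≤ 1) ↔ ∀ u ∈ N, ∀ v ∈ N,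
      (SimpleGraph.fromEdgeSet (S : Set (Sym2 W))).Reachable u v → u = v := by
  constructor
  · intro h u hu v hv huv
    exact card_le_one.1 (h _ (SimpleGraph.blockOf_mem_blocks S u)) u
      (mem_inter.2 ⟨SimpleGraph.self_mem_blockOf S u, hu⟩) v
      (mem_inter.2 ⟨SimpleGraph.mem_blockOf.2 huv, hv⟩)
  · intro h C hC
    refine card_le_one.2 fun u hu v hv => ?_
    rw [mem_inter] at hu hv
    refine h u hu.2 v hv.2 ?_
    rw [← SimpleGraph.blockOf_eq_iff, ← SimpleGraph.eq_blockOf hC hu.1,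
      ← SimpleGraph.eq_blockOf hC hv.1]

theorem SimpleGraph.reachable_image_val_iff [DecidableEq V] {p : V → Prop}
    (S : Finset (Sym2 {v // p v})) (a b : {v // p v}) :
    (fromEdgeSet ((S.image (Sym2.map Subtype.val) : Finset (Sym2 V)) : Set (Sym2 V))).Reachable
      (a : V) b ↔ (fromEdgeSet (S : Set (Sym2 {v // p v}))).Reachable a b := by
  have hinj : Function.Injective (Sym2.map (Subtype.val : {v // p v} → V)) :=
    Sym2.map.injective Subtype.val_injective
  constructor
  · intro h
    have key : ∀ x : V, (fromEdgeSet ((S.image (Sym2.map Subtype.val) : Finset (Sym2 V)) :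
        Set (Sym2 V))).Reachable (a : V) x →
        ∃ c : {v // p v}, (c : V) = x ∧
          (fromEdgeSet (S : Set (Sym2 {v // p v}))).Reachable a c := by
      intro x hx
      rw [reachable_iff_reflTransGen] at hx
      induction hx with
      | refl => exact ⟨a, rfl, Reachable.refl _⟩
      | @tail y z _ hyz ih =>
        obtain ⟨c, rfl, hc⟩ := ih
        rw [fromEdgeSet_adj, mem_coe, mem_image] at hyz
        obtain ⟨⟨e, he, hez⟩, hne⟩ := hyz
        have hz : z ∈ Sym2.map Subtype.val e := by rw [hez]; simp
        obtain ⟨z', _, rfl⟩ := Sym2.mem_map.1 hz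
        have he' : e = s(c, z') := hinj (by rw [hez, Sym2.map_mk])
        subst he'
        exact ⟨z', rfl, hc.trans (Adj.reachable (by
          rw [fromEdgeSet_adj]
          exact ⟨he, fun h => hne (congrArg Subtype.val h)⟩))⟩
    obtain ⟨c, hc, hac⟩ := key b h
    rwa [← Subtype.ext hc]
  · intro h
    let f : fromEdgeSet (S : Set (Sym2 {v // p v})) →g
        fromEdgeSet ((S.image (Sym2.map Subtype.val) : Finset (Sym2 V)) : Set (Sym2 V)) :=
      ⟨Subtype.val, by
        intro x y hxy
        rw [fromEdgeSet_adj] at hxy ⊢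
        refine ⟨?_, fun h => hxy.2 (Subtype.ext h)⟩
        rw [mem_coe, mem_image]
        exact ⟨_, hxy.1, rfl⟩⟩
    exact h.map f

/-- This moves the count from the graph on internal vertices to edge sets on all of `V`, where the
cycle data live. The added vertices are isolated and outside `leafSupports`, so the condition is
unchanged. -/
theorem SimpleGraph.sum_internalEdges [DecidableEq V] (N : Finset {v // 2 ≤ G.degree v})
    (hN : ∀ v, v ∈ N ↔ (v : V) ∈ G.leafSupports) :
    ∑ S ∈ (G.comap (Subtype.val : {v // 2 ≤ G.degree v} → V)).edgeFinset.powerset,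
        (-1 : ℚ) ^ #S * (if ∀ C ∈ blocks S, #(C ∩ N) ≤ 1 then 1 else 0) =
      ∑ S ∈ G.internalEdges.powerset, (-1 : ℚ) ^ #S *
        (if ∀ C ∈ blocks S, #(C ∩ G.leafSupports) ≤ 1 then 1 else 0) := by
  have hinj : Function.Injective (Sym2.map (Subtype.val : {v // 2 ≤ G.degree v} → V)) :=
    Sym2.map.injective Subtype.val_injective
  have hE : G.internalEdges =
      (G.comap (Subtype.val : {v // 2 ≤ G.degree v} → V)).edgeFinset.image
        (Sym2.map Subtype.val) := by
    ext e
    induction e using Sym2.ind with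
    | _ x y =>
    rw [mem_internalEdges, mem_image]
    constructor
    · rintro ⟨h, hx, hy⟩
      exact ⟨s(⟨x, hx⟩, ⟨y, hy⟩), by simpa using h, rfl⟩
    · rintro ⟨e, he, heq⟩
      induction e using Sym2.ind with
      | _ a b =>
      rw [mem_edgeFinset, mem_edgeSet, comap_adj] at he
      rw [Sym2.map_mk, Sym2.eq_iff] at heq
      rcases heq with ⟨rfl, rfl⟩ | ⟨rfl, rfl⟩
      · exact ⟨he, a.2, b.2⟩
      · exact ⟨he.symm, b.2, a.2⟩
  have himage : G.internalEdges.powerset =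
      (G.comap (Subtype.val : {v // 2 ≤ G.degree v} → V)).edgeFinset.powerset.image
        (fun S => S.image (Sym2.map Subtype.val)) := by
    ext S
    rw [hE, mem_powerset, subset_image_iff]
    simp
  rw [himage, sum_image (fun S _ T _ h => image_injective hinj h)]
  refine sum_congr rfl fun S _ => ?_
  rw [card_image_of_injective _ hinj]
  congr 1
  refine ite_eq_ite_of_iff ?_ _ _
  rw [blocks_inter_card_le_one_iff, blocks_inter_card_le_one_iff]
  constructor
  · intro h u hu v hv huv
    have hu2 := (mem_leafSupports.1 hu).1
    have hv2 := (mem_leafSupports.1 hv).1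
    exact congrArg Subtype.val (h ⟨u, hu2⟩ ((hN _).2 hu) ⟨v, hv2⟩ ((hN _).2 hv)
      ((reachable_image_val_iff S ⟨u, hu2⟩ ⟨v, hv2⟩).1 huv))
  · intro h u hu v hv huv
    exact Subtype.ext (h u ((hN u).1 hu) v ((hN v).1 hv) ((reachable_image_val_iff S u v).2 huv))

/-- Were the only neighbor also of degree one, the two vertices would form a whole component, which
could not contain `c`. -/
theorem SimpleGraph.Connected.exists_unique_neighbor (hconn : G.Connected) {c : V}
    (hc : 2 ≤ G.degree c) {v : V} (hv : ¬ 2 ≤ G.degree v) :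
    ∃ u : {u // 2 ≤ G.degree u}, ∀ w, G.Adj v w ↔ w = u := by
  have hne : v ≠ c := fun h => hv (h ▸ hc)
  have : Nontrivial V := ⟨v, c, hne⟩
  have hpos := hconn.preconnected.degree_pos_of_nontrivial v
  have h1 : #(G.neighborFinset v) = 1 := by
    rw [card_neighborFinset_eq_degree]
    omega
  obtain ⟨u, hu⟩ := card_eq_one.1 h1
  have hadj : ∀ w, G.Adj v w ↔ w = u := by
    intro w
    rw [← mem_neighborFinset, hu, mem_singleton]
  refine ⟨⟨u, ?_⟩, hadj⟩
  by_contra hu2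
  have hvu : G.Adj v u := (hadj u).2 rfl
  have hu1 : #(G.neighborFinset u) ≤ 1 := by
    rw [card_neighborFinset_eq_degree]
    omega
  have key : ∀ x, G.Reachable v x → x = v ∨ x = u := by
    intro x h
    rw [reachable_iff_reflTransGen] at h
    induction h with
    | refl => exact Or.inl rfl
    | @tail y z _ hyz ih =>
      rcases ih with rfl | rfl
      · exact Or.inr ((hadj z).1 hyz)
      · refine Or.inl (card_le_one.1 hu1 _ ?_ _ ?_)
        · rwa [mem_neighborFinset]
        · rw [mem_neighborFinset]
          exact hvu.symm
  rcases key c (hconn.preconnected v c) with rfl | rfl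
  · exact hne rfl
  · exact hu2 hc

theorem SimpleGraph.IsUnicyclic.exists_two_le_degree (huni : G.IsUnicyclic) :
    ∃ c, 2 ≤ G.degree c := by
  classical
  obtain ⟨cyc, K, a, b, -, -, hsub, hab, hmem, -, hdeg, -⟩ := huni.exists_cycle
  refine ⟨a, ?_⟩
  rw [← hdeg a (hmem _ hab a (by simp)), ← card_incidenceFinset_eq_degree]
  refine card_le_card fun e he => ?_
  rw [mem_filter] at he
  rw [mem_incidenceFinset]
  exact ⟨mem_edgeFinset.1 (hsub he.1), he.2⟩

end InternalVertices

/-! ### Assembly: expansion, leading partition and its coefficient -/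

theorem mainTheorem4 {V : Type*} [Fintype V] (G : SimpleGraph V) [DecidableRel G.Adj]
    (hconn : G.Connected) (huni : G.IsUnicyclic)
    (r s p : ℕ) (hr : G.nontrivialRoots.ncard = r) (hs : G.sprouts.card = s)
    (hp : G.nonSproutDeep.card = p) (hr2 : 2 ≤ r) :
    ∃ c : (Fintype.card V).Partition → ℚ,
      IsStarExpansion G c ∧ (∀ c', IsStarExpansion G c' → c' = c) ∧
      ∃ lam, IsLeadingPartition c lam ∧
        c lam = (-1) ^ (p + s) *
          ((∏ u ∈ G.nonSproutDeep, ((G.degree u : ℚ) - 1)) *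
            (if r = s then
              (∏ v ∈ G.sprouts, ((G.degree v : ℚ) - 1)) - (∑ v ∈ G.sprouts, (G.degree v : ℚ))
                + 2 * (s : ℚ) - 1
            else if r = s + 1 then
              (∏ v ∈ G.sprouts, ((G.degree v : ℚ) - 1)) - 1
            else
              ∏ v ∈ G.sprouts, ((G.degree v : ℚ) - 1))) := by
  classical
  obtain ⟨c₀, hc₀⟩ := huni.exists_two_le_degree
  choose nb hnb using fun l : {v // ¬ 2 ≤ G.degree v} =>
    hconn.exists_unique_neighbor hc₀ l.2
  set E := (G.comap (Subtype.val : {v // 2 ≤ G.degree v} → V)).edgeFinset with hE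
  set l : {v // 2 ≤ G.degree v} → ℕ := fun v => #{x | nb x = v} with hl
  set N : Finset {v // 2 ≤ G.degree v} := {v | 0 < l v} with hN
  have hmemN : ∀ v, v ∈ N ↔ 0 < l v := fun v => by simp [hN]
  have hleaf : ∀ x : {v // ¬ 2 ≤ G.degree v}, G.degree (x : V) = 1 := by
    intro x
    have h := x.2
    have : 0 < G.degree (x : V) := (G.degree_pos_iff_exists_adj _).2 ⟨_, (hnb x _).2 rfl⟩
    omega
  have hNleaf : ∀ v, v ∈ N ↔ (v : V) ∈ G.leafSupports := by
    intro v
    rw [hmemN, hl, card_pos, SimpleGraph.mem_leafSupports]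
    constructor
    · rintro ⟨x, hx⟩
      rw [mem_filter] at hx
      exact ⟨v.2, x, ((hnb x _).2 (by rw [hx.2])).symm, hleaf x⟩
    · rintro ⟨-, w, hw, hw1⟩
      refine ⟨⟨w, by omega⟩, mem_filter.2 ⟨mem_univ _, Subtype.ext ?_⟩⟩
      exact ((hnb ⟨w, by omega⟩ v).1 hw.symm).symm
  have hsum : ∑ v, (l v + 1) = Fintype.card V := by
    have h1 : ∑ v, l v = Fintype.card {v // ¬ 2 ≤ G.degree v} := by
      rw [← card_univ, card_eq_sum_card_fiberwise (f := nb) (t := univ) (by simp)]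
    rw [sum_add_distrib, h1, sum_const, card_univ, smul_eq_mul, mul_one,
      Fintype.card_subtype_compl]
    have := Fintype.card_subtype_le fun v => 2 ≤ G.degree v
    omega
  have hexp : IsStarExpansion G fun lam =>
      ∑ i ∈ expansionIndex E with expansionParts l i = lam.parts, expansionCoeff i := by
    rw [IsStarExpansion, ← sum_smul_eq_sum_partition (expansionIndex E) expansionCoeff
      (expansionParts l) (fun i _ k hk => pos_of_mem_expansionParts l i hk)
      (fun i hi => (sum_expansionParts l hi).trans hsum)]
    exact chromaticSymm_eq_sum G (fun v => 2 ≤ G.degree v) nb hnb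
  have hlead_sum : (leadParts l).sum = Fintype.card V := by
    rw [← hsum, leadParts, ← Multiset.coe_sumAddMonoidHom, map_sum]
    simp
  have hlead_pos : ∀ {k : ℕ}, k ∈ leadParts l → 0 < k := by
    intro k hk
    rw [leadParts, Multiset.mem_sum] at hk
    obtain ⟨v, -, hv⟩ := hk
    rw [Multiset.mem_singleton] at hv
    omega
  have hcoeff : ∑ i ∈ expansionIndex E with expansionParts l i = leadParts l, expansionCoeff i =
      _ := (sum_expansionCoeff_leadParts l hmemN E).trans
    ((SimpleGraph.sum_internalEdges N hNleaf).trans (huni.signed_count hr hs hp))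
  refine ⟨_, hexp, fun c' hc' => hexp.unique hc',
    ⟨leadParts l, hlead_pos, hlead_sum⟩, ⟨?_, ?_⟩, hcoeff⟩
  · exact hcoeff.trans_ne (SimpleGraph.signed_count_value_ne_zero p hs hr2)
  · intro mu hmu
    obtain ⟨i, hi, -⟩ := exists_ne_zero_of_sum_ne_zero hmu
    rw [mem_filter] at hi
    -- A partition of `n` has at most `n` parts, so the base `n + 1` is large enough.
    refine partsList_le_of_lexWeight_le (B := Fintype.card V + 1) ?_ ?_
    · have h1 := Multiset.card_nsmul_le_sum (s := mu.parts) (a := 1) fun k hk => mu.parts_pos hk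
      rw [mu.parts_sum, smul_eq_mul, mul_one] at h1
      omega
    · rw [← hi.2]
      exact (lexWeight_leadParts_le l hmemN
        (Nat.lt_succ_of_le (Fintype.card_subtype_le _)) i).1
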